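/- Let $(M,g)$ be a smooth two-dimensional Riemannian manifold with Levi-Civita connection $\nabla$, let $\mathcal D$ be the unit circle or the unit interval, and let $c(s,t)$, $s\in I=[0,1]$, $t\in\mathcal D$, be a smooth path of smooth immersed curves $c(s,\cdot):\mathcal D\to M$. Let primes denote derivatives in $s$ and dots derivatives in $t$; put $\omega=|\dot c|$, $T=\dot c/\omega$, $d\theta=\omega\,dt$, $f_\theta=\omega^{-1}\partial_t f$, $\nabla_T=\omega^{-1}\nabla_{\partial_t}$. Let $N$ be a smooth unit normal field of the curves, let $\kappa=g(\nabla_TT,N)$ be the signed curvature, $\rho=g(c',N)$, and let $K=K(N,T)$ be the sectional curvature of $M$ at $c(s,t)$. The space of immersed curves carries the metric $$G_c(h,k)=\int_{\mathcal D} \big(g(h,k)+g(\nabla_Th,\nabla_Tk)\big)\,d\theta .$$ The path is called normal if $g(c',T)=0$, and horizontal if for every $s$ one has $G_{c}(c',a\dot c)=0$ for all smooth $a:\mathcal D\to\mathbb R$ (with $a(0)=a(1)=0$ if $\mathcal D$ is the interval). Its speed is $\nu=\sqrt{G_c(c',c')}$, and it is called a geodesic here if $\nu'=0$ (the geodesic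 equation in integrated form). $T$ is parallel along the path if $\nabla_{c'}T=0$ everywhere. Suppose that the path is normal and horizontal and that $\rho$ vanishes nowhere. Then the following holds. (a) If $T$ is parallel along the path, then $\kappa_\theta=0$ everywhere, that is, all $t$-curves have constant curvature. Suppose moreover that the set of those $s\in I$ for which $\kappa(s,\cdot)$ is not identically zero is dense in $I$ (for example, that no $t$-curve is a geodesic of $M$). Then, conversely, $\kappa_\theta=0$ everywhere implies that $T$ is parallel along the path. In this case, the path is a geodesic if and only if there are positive numbers $\alpha(t)$, not depending on $s$, such that $$(\omega')^2=\frac{\alpha\,\omega\,\kappa^2}{1+\kappa^2}$$ for all $s$ and $t$. If, in addition, $\omega(s_0,\cdot)$ is constant for some $s_0\in I$, then the path is a geodesic if and only if this identity holds with one positive constant $\alpha$, independent of $s$ and $t$. (b) $\kappa'=0$ everywhere if and only if $2\kappa\kappa_{\theta\theta}=3\kappa_\theta^2+4\kappa^2(\kappa^2+K)$ everywhere. Moreover, at each single $(s,t)$ with $\kappa(s,t)\neq0$, one has $\kappa'(s,t)=0$ if and only if this identity holds at $(s,t)$. -/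

import Mathlib

open Set Bundle
open scoped Manifold ContDiff

noncomputable section

namespace SurfaceCurves

/-! ### The parameter domain of the curves -/

/-- The two possible parameter domains: the unit circle and the unit interval. -/
inductive ParamDomain
  | circle
  | interval

namespace ParamDomain

/-- The range of the real parameter `t`. A map on the circle is represented by a `2π`-periodic map
on the whole line. -/
def carrier : ParamDomain → Set ℝ
  | circle => univ
  | interval => Icc 0 1

/-- The upper end of a fundamental range `[0, D.length]` of the parameter. -/
def length : ParamDomain → ℝ
  | circle => 2 * Real.pi
  | interval => 1

/-- The function `f` of the real parameter descends to the parameter domain. -/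
def Descends {X : Type*} : ParamDomain → (ℝ → X) → Prop
  | circle, f => Function.Periodic f (2 * Real.pi)
  | interval, _ => True

/-- Vanishing at the endpoints (void on the circle). -/
def VanishesAtEnds : ParamDomain → (ℝ → ℝ) → Prop
  | circle, _ => True
  | interval, a => a 0 = 0 ∧ a 1 = 0

/-- The smooth functions `a` on the parameter domain, with `a 0 = a 1 = 0` on the interval. -/
def IsTestFunction (D : ParamDomain) (a : ℝ → ℝ) : Prop :=
  ContDiffOn ℝ ∞ a D.carrier ∧ D.Descends a ∧ D.VanishesAtEnds a

end ParamDomain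

section Surface

variable {M : Type*} [TopologicalSpace M] [ChartedSpace (EuclideanSpace ℝ (Fin 2)) M]
  [IsManifold (𝓡 2) ∞ M] [RiemannianBundle (fun x : M => TangentSpace (𝓡 2) x)]

/-! ### Levi-Civita connection and curvature in charts

The chart centred at `p` is `extChartAt (𝓡 2) p`; `x` denotes a point of its target. -/

/-- The components of a tangent vector `v` at `q`, in the chart centred at `p`. -/
def coord (p : M) {q : M} (v : TangentSpace (𝓡 2) q) : EuclideanSpace ℝ (Fin 2) :=
  (trivializationAt (EuclideanSpace ℝ (Fin 2)) (fun x : M => TangentSpace (𝓡 2) x)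
    p).continuousLinearMapAt ℝ q v

/-- The tangent vector at `q` whose components in the chart centred at `p` are `v`. -/
def ofCoord (p q : M) (v : EuclideanSpace ℝ (Fin 2)) : TangentSpace (𝓡 2) q :=
  (trivializationAt (EuclideanSpace ℝ (Fin 2)) (fun x : M => TangentSpace (𝓡 2) x)
    p).symmL ℝ q v

/-- The matrix `g_{ij}(x)` of the metric in the chart centred at `p`. -/
def gram (p : M) (x : EuclideanSpace ℝ (Fin 2)) : Matrix (Fin 2) (Fin 2) ℝ :=
  Matrix.of fun i j =>
    inner ℝ (ofCoord p ((extChartAt (𝓡 2) p).symm x) (EuclideanSpace.single i 1))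
      (ofCoord p ((extChartAt (𝓡 2) p).symm x) (EuclideanSpace.single j 1))

/-- The partial derivative `∂_i f (x)`. -/
def pderiv (i : Fin 2) (f : EuclideanSpace ℝ (Fin 2) → ℝ) (x : EuclideanSpace ℝ (Fin 2)) : ℝ :=
  fderiv ℝ f x (EuclideanSpace.single i 1)

/-- The Christoffel symbol `Γ^k_{ij}(x)` of the Levi-Civita connection in the chart centred
at `p`. -/
def christoffel (p : M) (k i j : Fin 2) (x : EuclideanSpace ℝ (Fin 2)) : ℝ :=
  (1 / 2) * ∑ l, (gram p x)⁻¹ k l *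
    (pderiv i (fun y => gram p y j l) x + pderiv j (fun y => gram p y i l) x
      - pderiv l (fun y => gram p y i j) x)

/-- The components of `R(∂_i, ∂_j) ∂_k = ∇_i ∇_j ∂_k - ∇_j ∇_i ∂_k = ∑ l, R^l_{kij} ∂_l`. -/
def riemann (p : M) (l k i j : Fin 2) (x : EuclideanSpace ℝ (Fin 2)) : ℝ :=
  pderiv i (christoffel p l j k) x - pderiv j (christoffel p l i k) x
    + ∑ m, (christoffel p l i m x * christoffel p m j k x
        - christoffel p l j m x * christoffel p m i k x)

/-- The vector `R(u, v) w` at `p`. -/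
def curvatureTensor (p : M) (u v w : TangentSpace (𝓡 2) p) : TangentSpace (𝓡 2) p :=
  ofCoord p p (WithLp.toLp 2 fun l => ∑ i, ∑ j, ∑ k,
    riemann p l k i j (extChartAt (𝓡 2) p p) * coord p u i * coord p v j * coord p w k)

/-- The sectional curvature `K(u, v)` of the plane spanned by `u` and `v`. -/
def sectionalCurvature (p : M) (u v : TangentSpace (𝓡 2) p) : ℝ :=
  inner ℝ (curvatureTensor p u v v) u
    / (inner ℝ u u * inner ℝ v v - inner ℝ u v ^ 2)

/-- The covariant derivative at `u` of the vector field `V` along the curve `γ : S → M`, computed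
in the chart centred at `p`; derivatives are taken within the parameter set `S`. -/
def covDerivInChart (p : M) (S : Set ℝ) (γ : ℝ → M) (V : (u : ℝ) → TangentSpace (𝓡 2) (γ u))
    (u : ℝ) : TangentSpace (𝓡 2) (γ u) :=
  ofCoord p (γ u) (WithLp.toLp 2 fun k =>
    derivWithin (fun r => coord p (V r) k) S u
      + ∑ i, ∑ j, christoffel p k i j (extChartAt (𝓡 2) p (γ u))
          * derivWithin (fun r => extChartAt (𝓡 2) p (γ r) i) S u * coord p (V u) j)

/-- The Levi-Civita covariant derivative at `u` of the vector field `V` along `γ : S → M`. -/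
def covDeriv (S : Set ℝ) (γ : ℝ → M) (V : (u : ℝ) → TangentSpace (𝓡 2) (γ u)) (u : ℝ) :
    TangentSpace (𝓡 2) (γ u) :=
  covDerivInChart (γ u) S γ V u

/-! ### Curves -/

variable (D : ParamDomain)

/-- The velocity of a curve with parameter domain `D`. -/
def velocity (γ : ℝ → M) (t : ℝ) : TangentSpace (𝓡 2) (γ t) :=
  mfderivWithin 𝓘(ℝ, ℝ) (𝓡 2) γ D.carrier t (1 : ℝ)

/-- The length element `ω = |γ̇|`. -/
def omega (γ : ℝ → M) (t : ℝ) : ℝ := ‖velocity D γ t‖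

/-- The unit tangent field `T`. -/
def unitTangent (γ : ℝ → M) (t : ℝ) : TangentSpace (𝓡 2) (γ t) :=
  (omega D γ t)⁻¹ • velocity D γ t

/-- The derivative `∇_T V` of a vector field `V` along the curve `γ`. -/
def nablaT (γ : ℝ → M) (V : (t : ℝ) → TangentSpace (𝓡 2) (γ t)) (t : ℝ) :
    TangentSpace (𝓡 2) (γ t) :=
  (omega D γ t)⁻¹ • covDeriv D.carrier γ V t

/-- The derivative `∂_θ f` of a function with respect to the arc length of `γ`. -/
def arcDeriv (γ : ℝ → M) (f : ℝ → ℝ) (t : ℝ) : ℝ :=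
  (omega D γ t)⁻¹ * derivWithin f D.carrier t

/-- The signed curvature `κ = g(∇_T T, N)` with respect to the unit normal field `N`. -/
def curvature (γ : ℝ → M) (N : (t : ℝ) → TangentSpace (𝓡 2) (γ t)) (t : ℝ) : ℝ :=
  inner ℝ (nablaT D γ (unitTangent D γ) t) (N t)

/-- The first order Sobolev metric `G_γ(h, k) = ∫ g(h, k) + g(∇_T h, ∇_T k) dθ`. -/
def sobolevMetric (γ : ℝ → M) (h k : (t : ℝ) → TangentSpace (𝓡 2) (γ t)) : ℝ :=
  ∫ t in (0 : ℝ)..D.length,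
    (inner ℝ (h t) (k t) + inner ℝ (nablaT D γ h t) (nablaT D γ k t)) * omega D γ t

/-- The field `h` along `γ` is `G`-orthogonal to all vertical fields `a γ̇`. -/
def IsHorizontalField (γ : ℝ → M) (h : (t : ℝ) → TangentSpace (𝓡 2) (γ t)) : Prop :=
  ∀ a : ℝ → ℝ, D.IsTestFunction a → sobolevMetric D γ h (fun t => a t • velocity D γ t) = 0

/-! ### Paths of curves, `c s t` with `s ∈ [0, 1]` the path parameter -/

/-- `c` is a smooth path in the space of smooth immersed curves with parameter domain `D`. -/
structure IsCurvePath (c : ℝ → ℝ → M) : Prop where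
  smooth : ContMDiffOn 𝓘(ℝ, ℝ × ℝ) (𝓡 2) ∞ (fun q : ℝ × ℝ => c q.1 q.2) (Icc 0 1 ×ˢ D.carrier)
  descends : ∀ s ∈ Icc (0 : ℝ) 1, D.Descends (c s)
  immersed : ∀ s ∈ Icc (0 : ℝ) 1, ∀ t ∈ D.carrier, velocity D (c s) t ≠ 0

/-- `N` is a smooth unit normal field of the curves of the path `c`. -/
structure IsUnitNormalField (c : ℝ → ℝ → M) (N : (s t : ℝ) → TangentSpace (𝓡 2) (c s t)) :
    Prop where
  smooth : ContMDiffOn 𝓘(ℝ, ℝ × ℝ) (𝓡 2).tangent ∞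
    (fun q : ℝ × ℝ => (⟨c q.1 q.2, N q.1 q.2⟩ : TangentBundle (𝓡 2) M)) (Icc 0 1 ×ˢ D.carrier)
  descends : ∀ s ∈ Icc (0 : ℝ) 1,
    D.Descends fun t => (⟨c s t, N s t⟩ : TangentBundle (𝓡 2) M)
  unit : ∀ s ∈ Icc (0 : ℝ) 1, ∀ t ∈ D.carrier, inner ℝ (N s t) (N s t) = (1 : ℝ)
  normal : ∀ s ∈ Icc (0 : ℝ) 1, ∀ t ∈ D.carrier, inner ℝ (N s t) (velocity D (c s) t) = (0 : ℝ)

/-- The tangent field `c'` of the path. -/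
def pathVelocity (c : ℝ → ℝ → M) (s t : ℝ) : TangentSpace (𝓡 2) (c s t) :=
  mfderivWithin 𝓘(ℝ, ℝ) (𝓡 2) (fun r => c r t) (Icc 0 1) s (1 : ℝ)

/-- The derivative `f'` of a function with respect to the path parameter. -/
def pathDeriv (f : ℝ → ℝ → ℝ) (s t : ℝ) : ℝ :=
  derivWithin (fun r => f r t) (Icc 0 1) s

/-- The path is normal: `g(c', T) = 0`. -/
def IsNormalPath (c : ℝ → ℝ → M) : Prop :=
  ∀ s ∈ Icc (0 : ℝ) 1, ∀ t ∈ D.carrier,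
    inner ℝ (pathVelocity c s t) (unitTangent D (c s) t) = (0 : ℝ)

/-- The path is horizontal: its tangent field is horizontal. -/
def IsHorizontalPath (c : ℝ → ℝ → M) : Prop :=
  ∀ s ∈ Icc (0 : ℝ) 1, IsHorizontalField D (c s) (pathVelocity c s)

/-- The unit tangent field `T` is parallel along the path: `∇_{c'} T = 0`. -/
def TangentIsParallel (c : ℝ → ℝ → M) : Prop :=
  ∀ s ∈ Icc (0 : ℝ) 1, ∀ t ∈ D.carrier,
    covDeriv (Icc 0 1) (fun r => c r t) (fun r => unitTangent D (c r) t) s = 0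

/-- The speed `ν = √G(c', c')` of the path. -/
def pathSpeed (c : ℝ → ℝ → M) (s : ℝ) : ℝ :=
  Real.sqrt (sobolevMetric D (c s) (pathVelocity c s) (pathVelocity c s))

/-- The geodesic equation in integrated form, `ν' = 0`. -/
def HasConstantSpeed (c : ℝ → ℝ → M) : Prop :=
  ∀ s ∈ Icc (0 : ℝ) 1, HasDerivWithinAt (pathSpeed D c) 0 (Icc 0 1) s

end Surface

end SurfaceCurves

end

set_option linter.unusedSectionVars false

namespace SurfaceCurves

/-! ### Calculus on the strip of parameters -/

namespace ParamDomain

/-! Along a normal path `c' = ρN` and `ċ = ωT`, so everything follows from the equations of the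
moving frame `(T, N)`. Vanishing torsion, `∇_s ċ = ∇_t c'`, has two components: `ω' = -ρκω` and `∇_s
T = ρ_θ N` (`first_structure_equations`). Hence `T` is parallel iff `ρ_θ = 0`. Commuting `∇_s` and
`∇_t` on `T` gives `κ' = ρ_θθ + ρ(κ² + K)` (`pathDeriv_curvature`). Horizontality, integrated by
parts against vertical fields, becomes `2ρ_θκ + ρκ_θ = 0` (`horizontal_equation`); equivalently
`ρ²κ` is constant along each curve.

For (a), the last equation turns `ρ_θ = 0` into `κ_θ = 0`, since `ρ ≠ 0`; conversely `κ_θ = 0` gives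
`ρ_θ = 0` wherever `κ ≠ 0`, and density and continuity do the rest. When `ρ` and `κ` depend on `s`
only, so does the logarithmic derivative `-ρκ` of `ω`, whence the functions `ω(s,·)` are all
proportional (`omega_mul_omega`). The squared speed is the integral over `t` of `e = ρ²(1+κ²)ω`, and
proportionality makes this integral constant in `s` iff `e(s,t)` is, for each `t`
(`hasConstantSpeed_iff`). Since `ω'² = ρ²κ²ω² = eωκ²/(1+κ²)`, the number `α(t)` is this common value
of `e`.

For (b), the horizontality equation is differentiated once more and `ρ_θθ` and `ρ_θ` are eliminated
from the evolution of `κ`. The result is `4κ²κ' = ρ(3κ_θ² + 4κ²(κ²+K) - 2κκ_θθ)`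
(`sq_mul_pathDeriv_curvature`). This settles the points with `κ ≠ 0`. If the left side vanishes
along a whole `s`-line, then `(κ³)' = 0` there, so `κ` is constant in `s` and zeros of `κ` do no
harm.

The covariant derivative is defined in the chart centred at the current point, and this chart moves
when one differentiates again. The frame equations are therefore proved in an arbitrary fixed chart.
That `κ` does not depend on the chart, is smooth, and is periodic on the circle is read off `ω' =
-ρκω`, where `ω` and `ρ` involve no connection and `ρ` has no zeros. -/

theorem convex_carrier (D : ParamDomain) : Convex ℝ D.carrier := by
  cases D
  · exact convex_univ
  · exact convex_Icc 0 1

theorem nonempty_interior_carrier (D : ParamDomain) : (interior D.carrier).Nonempty := by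
  cases D
  · simp [carrier]
  · simp [carrier, interior_Icc]

theorem uniqueDiffOn_carrier (D : ParamDomain) : UniqueDiffOn ℝ D.carrier :=
  uniqueDiffOn_convex D.convex_carrier D.nonempty_interior_carrier

/-- The set of the parameters `(s, t)` of a path of curves. -/
def strip (D : ParamDomain) : Set (ℝ × ℝ) := Icc 0 1 ×ˢ D.carrier

theorem uniqueDiffOn_strip (D : ParamDomain) : UniqueDiffOn ℝ D.strip :=
  (uniqueDiffOn_Icc zero_lt_one).prod D.uniqueDiffOn_carrier

/-- Symmetry of second derivatives at a boundary point of the strip requires that the point be a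
limit of interior points; convexity provides this. -/
theorem mem_closure_interior_strip (D : ParamDomain) {q : ℝ × ℝ} (hq : q ∈ D.strip) :
    q ∈ closure (interior D.strip) := by
  have hconv : Convex ℝ D.strip := (convex_Icc 0 1).prod D.convex_carrier
  have hne : (interior D.strip).Nonempty := by
    rw [strip, interior_prod_eq, interior_Icc]
    exact (nonempty_Ioo.2 zero_lt_one).prod D.nonempty_interior_carrier
  rw [hconv.closure_interior_eq_closure_of_nonempty_interior hne]
  exact subset_closure hq

end ParamDomain

variable {D : ParamDomain} {f g : ℝ → ℝ → ℝ} {s t : ℝ}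

/-- The function `f` of `(s, t)` is smooth at `(s, t)` within the strip. -/
def SmoothAt (D : ParamDomain) (f : ℝ → ℝ → ℝ) (s t : ℝ) : Prop :=
  ContDiffWithinAt ℝ ∞ (fun q : ℝ × ℝ => f q.1 q.2) D.strip (s, t)

/-- The derivative of a function with respect to the curve parameter. -/
noncomputable def curveDeriv (D : ParamDomain) (f : ℝ → ℝ → ℝ) (s t : ℝ) : ℝ :=
  derivWithin (f s) D.carrier t

theorem hasDerivWithinAt_curry_left {F : ℝ × ℝ → ℝ} {L : ℝ × ℝ →L[ℝ] ℝ}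
    (h : HasFDerivWithinAt F L D.strip (s, t)) (ht : t ∈ D.carrier) :
    HasDerivWithinAt (fun r => F (r, t)) (L (1, 0)) (Icc 0 1) s :=
  h.comp_hasDerivWithinAt (f := fun r => (r, t)) (t := D.strip) s
    ((hasDerivWithinAt_id s _).prodMk (hasDerivWithinAt_const s _ t))
    fun _ hr => ⟨hr, ht⟩

theorem hasDerivWithinAt_curry_right {F : ℝ × ℝ → ℝ} {L : ℝ × ℝ →L[ℝ] ℝ}
    (h : HasFDerivWithinAt F L D.strip (s, t)) (hs : s ∈ Icc (0 : ℝ) 1) :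
    HasDerivWithinAt (fun r => F (s, r)) (L (0, 1)) D.carrier t :=
  h.comp_hasDerivWithinAt (f := fun r => (s, r)) (t := D.strip) t
    ((hasDerivWithinAt_const t _ s).prodMk (hasDerivWithinAt_id t _))
    fun _ hr => ⟨hs, hr⟩

/-- Chart formulas hold only near a point of the strip; restricting them to a coordinate line lets
them be used inside one-variable derivatives. -/
theorem eventually_strip_left {P : ℝ → ℝ → Prop} (ht : t ∈ D.carrier)
    (h : ∀ᶠ q in nhdsWithin (s, t) D.strip, P q.1 q.2) :
    ∀ᶠ r in nhdsWithin s (Icc 0 1), P r t := by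
  have hc : Filter.Tendsto (fun r => (r, t)) (nhdsWithin s (Icc 0 1))
      (nhdsWithin (s, t) D.strip) :=
    tendsto_nhdsWithin_iff.2 ⟨((continuous_id.prodMk continuous_const).tendsto s).mono_left
      nhdsWithin_le_nhds, eventually_nhdsWithin_of_forall fun _ hr => ⟨hr, ht⟩⟩
  exact hc.eventually h

theorem eventually_strip_right {P : ℝ → ℝ → Prop} (hs : s ∈ Icc (0 : ℝ) 1)
    (h : ∀ᶠ q in nhdsWithin (s, t) D.strip, P q.1 q.2) :
    ∀ᶠ r in nhdsWithin t D.carrier, P s r := by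
  have hc : Filter.Tendsto (fun r => (s, r)) (nhdsWithin t D.carrier)
      (nhdsWithin (s, t) D.strip) :=
    tendsto_nhdsWithin_iff.2 ⟨((continuous_const.prodMk continuous_id).tendsto t).mono_left
      nhdsWithin_le_nhds, eventually_nhdsWithin_of_forall fun _ hr => ⟨hs, hr⟩⟩
  exact hc.eventually h

namespace SmoothAt

theorem differentiableWithinAt (h : SmoothAt D f s t) :
    DifferentiableWithinAt ℝ (fun q : ℝ × ℝ => f q.1 q.2) D.strip (s, t) :=
  ContDiffWithinAt.differentiableWithinAt h (by simp)

theorem pathDeriv_eq (h : DifferentiableWithinAt ℝ (fun q : ℝ × ℝ => f q.1 q.2) D.strip (s, t))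
    (hs : s ∈ Icc (0 : ℝ) 1) (ht : t ∈ D.carrier) : pathDeriv f s t =
      fderivWithin ℝ (fun q : ℝ × ℝ => f q.1 q.2) D.strip (s, t) (1, 0) :=
  (hasDerivWithinAt_curry_left h.hasFDerivWithinAt ht).derivWithin
    (uniqueDiffOn_Icc zero_lt_one s hs)

theorem curveDeriv_eq (h : DifferentiableWithinAt ℝ (fun q : ℝ × ℝ => f q.1 q.2) D.strip (s, t))
    (hs : s ∈ Icc (0 : ℝ) 1) (ht : t ∈ D.carrier) : curveDeriv D f s t =
      fderivWithin ℝ (fun q : ℝ × ℝ => f q.1 q.2) D.strip (s, t) (0, 1) :=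
  (hasDerivWithinAt_curry_right h.hasFDerivWithinAt hs).derivWithin
    (D.uniqueDiffOn_carrier t ht)

theorem hasDerivWithinAt_left (h : SmoothAt D f s t) (ht : t ∈ D.carrier) :
    HasDerivWithinAt (fun r => f r t) (pathDeriv f s t) (Icc 0 1) s :=
  (hasDerivWithinAt_curry_left
    h.differentiableWithinAt.hasFDerivWithinAt ht).differentiableWithinAt.hasDerivWithinAt

theorem hasDerivWithinAt_right (h : SmoothAt D f s t) (hs : s ∈ Icc (0 : ℝ) 1) :
    HasDerivWithinAt (f s) (curveDeriv D f s t) D.carrier t :=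
  (hasDerivWithinAt_curry_right
    h.differentiableWithinAt.hasFDerivWithinAt hs).differentiableWithinAt.hasDerivWithinAt

theorem eventually_differentiableWithinAt (h : SmoothAt D f s t) (hq : (s, t) ∈ D.strip) :
    ∀ᶠ q in nhdsWithin (s, t) D.strip,
      DifferentiableWithinAt ℝ (fun q : ℝ × ℝ => f q.1 q.2) D.strip q := by
  have h1 := (ContDiffWithinAt.of_le (m := 1) h (by simp)).eventually (by simp)
  rw [insert_eq_of_mem hq] at h1
  exact h1.mono fun q hq => hq.differentiableWithinAt (by simp)

theorem fderivWithin (h : SmoothAt D f s t) (hq : (s, t) ∈ D.strip) :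
    ContDiffWithinAt ℝ ∞ (_root_.fderivWithin ℝ (fun q : ℝ × ℝ => f q.1 q.2) D.strip)
      D.strip (s, t) :=
  ContDiffWithinAt.fderivWithin_right h D.uniqueDiffOn_strip (by simp) hq

theorem congr_of_eventuallyEq (h : SmoothAt D f s t) (hq : (s, t) ∈ D.strip)
    (hfg : ∀ᶠ q in nhdsWithin (s, t) D.strip, g q.1 q.2 = f q.1 q.2) : SmoothAt D g s t :=
  ContDiffWithinAt.congr_of_eventuallyEq h hfg (hfg.self_of_nhdsWithin hq)

theorem eventually_pathDeriv_eq (h : SmoothAt D f s t) (hq : (s, t) ∈ D.strip) :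
    ∀ᶠ q in nhdsWithin (s, t) D.strip, SurfaceCurves.pathDeriv f q.1 q.2 =
      _root_.fderivWithin ℝ (fun q : ℝ × ℝ => f q.1 q.2) D.strip q (1, 0) := by
  filter_upwards [h.eventually_differentiableWithinAt hq, self_mem_nhdsWithin] with q h1 h2
  exact pathDeriv_eq h1 h2.1 h2.2

theorem eventually_curveDeriv_eq (h : SmoothAt D f s t) (hq : (s, t) ∈ D.strip) :
    ∀ᶠ q in nhdsWithin (s, t) D.strip, SurfaceCurves.curveDeriv D f q.1 q.2 =
      _root_.fderivWithin ℝ (fun q : ℝ × ℝ => f q.1 q.2) D.strip q (0, 1) := by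
  filter_upwards [h.eventually_differentiableWithinAt hq, self_mem_nhdsWithin] with q h1 h2
  exact curveDeriv_eq h1 h2.1 h2.2

/-- Near the point the partial derivative is the full derivative within the strip evaluated on `(1,
0)`, and the latter is again smooth. -/
theorem pathDeriv (h : SmoothAt D f s t) (hs : s ∈ Icc (0 : ℝ) 1) (ht : t ∈ D.carrier) :
    SmoothAt D (pathDeriv f) s t := by
  refine congr_of_eventuallyEq (f := fun a b =>
    _root_.fderivWithin ℝ (fun q : ℝ × ℝ => f q.1 q.2) D.strip (a, b) (1, 0)) ?_ ⟨hs, ht⟩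
    (h.eventually_pathDeriv_eq ⟨hs, ht⟩)
  exact (h.fderivWithin ⟨hs, ht⟩).clm_apply contDiffWithinAt_const

theorem curveDeriv (h : SmoothAt D f s t) (hs : s ∈ Icc (0 : ℝ) 1) (ht : t ∈ D.carrier) :
    SmoothAt D (curveDeriv D f) s t := by
  refine congr_of_eventuallyEq (f := fun a b =>
    _root_.fderivWithin ℝ (fun q : ℝ × ℝ => f q.1 q.2) D.strip (a, b) (0, 1)) ?_ ⟨hs, ht⟩
    (h.eventually_curveDeriv_eq ⟨hs, ht⟩)
  exact (h.fderivWithin ⟨hs, ht⟩).clm_apply contDiffWithinAt_const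

/-- Mixed partial derivatives commute. -/
theorem pathDeriv_curveDeriv (h : SmoothAt D f s t) (hs : s ∈ Icc (0 : ℝ) 1)
    (ht : t ∈ D.carrier) : SurfaceCurves.pathDeriv (SurfaceCurves.curveDeriv D f) s t =
      SurfaceCurves.curveDeriv D (SurfaceCurves.pathDeriv f) s t := by
  have hq : (s, t) ∈ D.strip := ⟨hs, ht⟩
  have hsymm := ContDiffWithinAt.isSymmSndFDerivWithinAt h
    (by rw [minSmoothness_of_isRCLikeNormedField]; exact WithTop.coe_le_coe.2 (le_top : (2 : ℕ∞) ≤ ⊤))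
    D.uniqueDiffOn_strip
    (D.mem_closure_interior_strip hq) hq
  have hd := ((h.fderivWithin hq).differentiableWithinAt (by simp)).hasFDerivWithinAt
  have key : ∀ v : ℝ × ℝ, HasFDerivWithinAt
      (fun q => _root_.fderivWithin ℝ (fun q : ℝ × ℝ => f q.1 q.2) D.strip q v)
      ((ContinuousLinearMap.apply ℝ ℝ v).comp (_root_.fderivWithin ℝ
        (_root_.fderivWithin ℝ (fun q : ℝ × ℝ => f q.1 q.2) D.strip) D.strip (s, t)))
      D.strip (s, t) := fun v =>
    (ContinuousLinearMap.apply ℝ ℝ v).hasFDerivAt.comp_hasFDerivWithinAt (s, t) hd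
  -- Partial derivatives agree with the full derivative throughout a neighbourhood in the strip, so
  -- they may be replaced by it before differentiating again.
  have e1 := h.eventually_curveDeriv_eq hq
  have e2 := h.eventually_pathDeriv_eq hq
  rw [pathDeriv_eq ((h.curveDeriv hs ht).differentiableWithinAt) hs ht,
    curveDeriv_eq ((h.pathDeriv hs ht).differentiableWithinAt) hs ht,
    Filter.EventuallyEq.fderivWithin_eq e1 (e1.self_of_nhdsWithin hq),
    Filter.EventuallyEq.fderivWithin_eq e2 (e2.self_of_nhdsWithin hq),
    (key _).fderivWithin (D.uniqueDiffOn_strip _ hq),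
    (key _).fderivWithin (D.uniqueDiffOn_strip _ hq)]
  exact hsymm (1, 0) (0, 1)

theorem const (a : ℝ) : SmoothAt D (fun _ _ => a) s t := contDiffWithinAt_const

theorem add (hf : SmoothAt D f s t) (hg : SmoothAt D g s t) :
    SmoothAt D (fun a b => f a b + g a b) s t := ContDiffWithinAt.add hf hg

theorem sub (hf : SmoothAt D f s t) (hg : SmoothAt D g s t) :
    SmoothAt D (fun a b => f a b - g a b) s t := ContDiffWithinAt.sub hf hg

theorem neg (hf : SmoothAt D f s t) :
    SmoothAt D (fun a b => - f a b) s t := ContDiffWithinAt.neg hf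

theorem mul (hf : SmoothAt D f s t) (hg : SmoothAt D g s t) :
    SmoothAt D (fun a b => f a b * g a b) s t := ContDiffWithinAt.mul hf hg

theorem inv (hf : SmoothAt D f s t) (h0 : f s t ≠ 0) :
    SmoothAt D (fun a b => (f a b)⁻¹) s t := ContDiffWithinAt.inv hf h0

theorem sum {ι : Type*} {S : Finset ι} {F : ι → ℝ → ℝ → ℝ}
    (h : ∀ i ∈ S, SmoothAt D (F i) s t) :
    SmoothAt D (fun a b => ∑ i ∈ S, F i a b) s t := ContDiffWithinAt.sum h

end SmoothAt

theorem pathDeriv_congr (ht : t ∈ D.carrier) (hs : s ∈ Icc (0 : ℝ) 1)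
    (hfg : ∀ᶠ q in nhdsWithin (s, t) D.strip, f q.1 q.2 = g q.1 q.2) :
    pathDeriv f s t = pathDeriv g s t :=
  Filter.EventuallyEq.derivWithin_eq
    (eventually_strip_left (P := fun a b => f a b = g a b) ht hfg)
    (hfg.self_of_nhdsWithin (show (s, t) ∈ D.strip from ⟨hs, ht⟩))

theorem curveDeriv_congr (ht : t ∈ D.carrier) (hs : s ∈ Icc (0 : ℝ) 1)
    (hfg : ∀ᶠ q in nhdsWithin (s, t) D.strip, f q.1 q.2 = g q.1 q.2) :
    curveDeriv D f s t = curveDeriv D g s t :=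
  Filter.EventuallyEq.derivWithin_eq
    (eventually_strip_right (P := fun a b => f a b = g a b) hs hfg)
    (hfg.self_of_nhdsWithin (show (s, t) ∈ D.strip from ⟨hs, ht⟩))

/-! ### Components of vectors and of the metric in a chart -/

section Charts

variable {M : Type*} [TopologicalSpace M] [ChartedSpace (EuclideanSpace ℝ (Fin 2)) M]
  [IsManifold (𝓡 2) ∞ M]

/-- The two sets coincide by definition for the tangent bundle. -/
theorem mem_baseSet {p q : M} (hq : q ∈ (chartAt (EuclideanSpace ℝ (Fin 2)) p).source) :
    q ∈ (trivializationAt (EuclideanSpace ℝ (Fin 2))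
      (fun x : M => TangentSpace (𝓡 2) x) p).baseSet := hq

theorem ofCoord_coord {p q : M} (hq : q ∈ (chartAt (EuclideanSpace ℝ (Fin 2)) p).source)
    (v : TangentSpace (𝓡 2) q) : ofCoord p q (coord p v) = v :=
  Trivialization.symmL_continuousLinearMapAt _ (mem_baseSet hq) v

theorem coord_ofCoord {p q : M} (hq : q ∈ (chartAt (EuclideanSpace ℝ (Fin 2)) p).source)
    (v : EuclideanSpace ℝ (Fin 2)) : coord p (ofCoord p q v) = v :=
  Trivialization.continuousLinearMapAt_symmL _ (mem_baseSet hq) v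

theorem coord_add (p : M) {q : M} (v w : TangentSpace (𝓡 2) q) :
    coord p (v + w) = coord p v + coord p w := map_add _ v w

theorem coord_smul (p : M) {q : M} (a : ℝ) (v : TangentSpace (𝓡 2) q) :
    coord p (a • v) = a • coord p v := map_smul _ a v

theorem ofCoord_add (p q : M) (v w : EuclideanSpace ℝ (Fin 2)) :
    ofCoord p q (v + w) = ofCoord p q v + ofCoord p q w := map_add _ v w

theorem ofCoord_smul (p q : M) (a : ℝ) (v : EuclideanSpace ℝ (Fin 2)) :
    ofCoord p q (a • v) = a • ofCoord p q v := map_smul _ a v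

/-- Identities between tangent vectors are reduced by this to scalar identities in a chart. -/
theorem coord_injective {p q : M} (hq : q ∈ (chartAt (EuclideanSpace ℝ (Fin 2)) p).source)
    {v w : TangentSpace (𝓡 2) q} (h : ∀ k, coord p v k = coord p w k) : v = w := by
  rw [← ofCoord_coord hq v, ← ofCoord_coord hq w]
  congr 1
  ext k
  exact h k

theorem ofCoord_eq_sum (p q : M) (v : EuclideanSpace ℝ (Fin 2)) :
    ofCoord p q v = v 0 • ofCoord p q (EuclideanSpace.single 0 1)
      + v 1 • ofCoord p q (EuclideanSpace.single 1 1) := by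
  rw [← ofCoord_smul, ← ofCoord_smul, ← ofCoord_add]
  congr 1
  ext k
  fin_cases k <;> simp

/-- The components of the velocity of a curve are the derivatives of its components. -/
theorem coord_mfderivWithin {p : M} {S : Set ℝ} {γ : ℝ → M} {u : ℝ}
    (hq : γ u ∈ (chartAt (EuclideanSpace ℝ (Fin 2)) p).source) (hS : UniqueDiffWithinAt ℝ S u)
    (hγ : MDifferentiableWithinAt 𝓘(ℝ, ℝ) (𝓡 2) γ S u) (k : Fin 2) :
    HasDerivWithinAt (fun r => extChartAt (𝓡 2) p (γ r) k)
      (coord p (mfderivWithin 𝓘(ℝ, ℝ) (𝓡 2) γ S u (1 : ℝ)) k) S u := by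
  have : IsManifold (𝓡 2) 1 M := IsManifold.of_le (n := ∞) (by simp)
  have hφ : MDifferentiableAt (𝓡 2) 𝓘(ℝ, EuclideanSpace ℝ (Fin 2)) (extChartAt (𝓡 2) p) (γ u) :=
    (contMDiffAt_extChartAt' (n := 1) hq).mdifferentiableAt (by simp)
  have hcomp := mfderiv_comp_mfderivWithin u hφ hγ hS.uniqueMDiffWithinAt
  have hd : DifferentiableWithinAt ℝ (extChartAt (𝓡 2) p ∘ γ) S u :=
    mdifferentiableWithinAt_iff_differentiableWithinAt.1
      (hφ.comp_mdifferentiableWithinAt u hγ)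
  rw [mfderivWithin_eq_fderivWithin] at hcomp
  have hv : coord p (mfderivWithin 𝓘(ℝ, ℝ) (𝓡 2) γ S u (1 : ℝ)) =
      fderivWithin ℝ (extChartAt (𝓡 2) p ∘ γ) S u 1 := by
    rw [hcomp, coord, TangentBundle.continuousLinearMapAt_trivializationAt hq]
    rfl
  rw [hv]
  have h1 := hd.hasFDerivWithinAt.hasDerivWithinAt
  exact (EuclideanSpace.proj (𝕜 := ℝ) k).hasFDerivAt.comp_hasDerivWithinAt u h1

theorem coord_eq_trivialization {p q : M}
    (hq : q ∈ (chartAt (EuclideanSpace ℝ (Fin 2)) p).source) (v : TangentSpace (𝓡 2) q) :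
    coord p v = (trivializationAt (EuclideanSpace ℝ (Fin 2))
      (fun x : M => TangentSpace (𝓡 2) x) p ⟨q, v⟩).2 := by
  rw [coord, Trivialization.continuousLinearMapAt_apply,
    Trivialization.coe_linearMapAt_of_mem _ (mem_baseSet hq)]

variable [RiemannianBundle (fun x : M => TangentSpace (𝓡 2) x)]

theorem gram_extChartAt {p q : M} (hq : q ∈ (chartAt (EuclideanSpace ℝ (Fin 2)) p).source)
    (i j : Fin 2) : gram p (extChartAt (𝓡 2) p q) i j =
      inner ℝ (ofCoord p q (EuclideanSpace.single i 1))
        (ofCoord p q (EuclideanSpace.single j 1)) := by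
  -- The inverse chart returns `q` only up to a propositional equality, and the tangent space
  -- depends on the point, so the point is generalized before substituting.
  have key : ∀ y : M, y = q → inner ℝ (ofCoord p y (EuclideanSpace.single i 1))
      (ofCoord p y (EuclideanSpace.single j 1)) =
      inner ℝ (ofCoord p q (EuclideanSpace.single i 1))
        (ofCoord p q (EuclideanSpace.single j 1)) := by
    rintro y rfl
    rfl
  exact key _ ((extChartAt (𝓡 2) p).left_inv (by rwa [extChartAt_source]))

/-- The inner product in components. -/
theorem inner_eq_sum {p q : M} (hq : q ∈ (chartAt (EuclideanSpace ℝ (Fin 2)) p).source)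
    (v w : TangentSpace (𝓡 2) q) : inner ℝ v w =
      ∑ i, ∑ j, gram p (extChartAt (𝓡 2) p q) i j * coord p v i * coord p w j := by
  conv_lhs => rw [← ofCoord_coord hq v, ← ofCoord_coord hq w, ofCoord_eq_sum p q (coord p v),
    ofCoord_eq_sum p q (coord p w)]
  simp only [Fin.sum_univ_two, gram_extChartAt hq, inner_add_left, inner_add_right,
    real_inner_smul_left, real_inner_smul_right]
  ring

theorem gram_comm (p : M) (x : EuclideanSpace ℝ (Fin 2)) (i j : Fin 2) :
    gram p x i j = gram p x j i := by
  simp only [gram, Matrix.of_apply]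
  exact real_inner_comm _ _

/-- A vector in the kernel of the Gram matrix has length zero, hence vanishes because the metric is
definite. -/
theorem isUnit_det_gram {p q : M} (hq : q ∈ (chartAt (EuclideanSpace ℝ (Fin 2)) p).source) :
    IsUnit (gram p (extChartAt (𝓡 2) p q)).det := by
  rw [isUnit_iff_ne_zero]
  intro h0
  obtain ⟨v, hv0, hv⟩ := Matrix.exists_mulVec_eq_zero_iff.2 h0
  have hw : ofCoord p q (WithLp.toLp 2 v) = 0 := by
    rw [← inner_self_eq_zero (𝕜 := ℝ), inner_eq_sum hq, coord_ofCoord hq]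
    have h1 := congrFun hv 0
    have h2 := congrFun hv 1
    simp only [Matrix.mulVec, dotProduct, Fin.sum_univ_two, Pi.zero_apply] at h1 h2
    simp only [Fin.sum_univ_two]
    linear_combination v 0 * h1 + v 1 * h2
  apply hv0
  have h3 := coord_ofCoord hq (WithLp.toLp 2 v)
  rw [hw] at h3
  have h4 : coord p (0 : TangentSpace (𝓡 2) q) = 0 := map_zero _
  rw [h4] at h3
  funext k
  exact (congrArg (fun z : EuclideanSpace ℝ (Fin 2) => z k) h3).symm

/-- This symmetry is the absence of torsion, in coordinates. -/
theorem christoffel_comm (p : M) (k i j : Fin 2) (x : EuclideanSpace ℝ (Fin 2)) :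
    christoffel p k i j x = christoffel p k j i x := by
  unfold christoffel
  congr 1
  refine Finset.sum_congr rfl fun l _ => ?_
  simp only [gram_comm p _ j i]
  ring

/-- The metric is parallel. -/
theorem pderiv_gram {p q : M} (hq : q ∈ (chartAt (EuclideanSpace ℝ (Fin 2)) p).source)
    (l i j : Fin 2) : pderiv l (fun y => gram p y i j) (extChartAt (𝓡 2) p q) =
      ∑ m, (gram p (extChartAt (𝓡 2) p q) m j * christoffel p m l i (extChartAt (𝓡 2) p q)
        + gram p (extChartAt (𝓡 2) p q) i m * christoffel p m l j (extChartAt (𝓡 2) p q)) := by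
  have hinv := Matrix.mul_nonsing_inv _ (isUnit_det_gram hq)
  -- Lowering the upper index cancels the inverse matrix and leaves the Christoffel symbols of the
  -- first kind.
  have lower : ∀ n a b, ∑ m, gram p (extChartAt (𝓡 2) p q) n m *
      christoffel p m a b (extChartAt (𝓡 2) p q) = (1 / 2) *
      (pderiv a (fun y => gram p y b n) (extChartAt (𝓡 2) p q)
        + pderiv b (fun y => gram p y a n) (extChartAt (𝓡 2) p q)
        - pderiv n (fun y => gram p y a b) (extChartAt (𝓡 2) p q)) := by
    intro n a b
    have e0 := congrFun (congrFun hinv n) 0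
    have e1 := congrFun (congrFun hinv n) 1
    simp only [Matrix.mul_apply, Fin.sum_univ_two] at e0 e1
    simp only [christoffel, Fin.sum_univ_two]
    -- Writing `F n` with Kronecker deltas lets the entries of `g g⁻¹ = 1` be inserted.
    have hd : ∀ (n : Fin 2) (F : Fin 2 → ℝ), F n = (1 : Matrix (Fin 2) (Fin 2) ℝ) n 0 * F 0 +
        (1 : Matrix (Fin 2) (Fin 2) ℝ) n 1 * F 1 := by
      intro n F
      match n with
      | 0 => simp
      | 1 => simp
    rw [hd n fun n => pderiv a (fun y => gram p y b n) (extChartAt (𝓡 2) p q)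
        + pderiv b (fun y => gram p y a n) (extChartAt (𝓡 2) p q)
        - pderiv n (fun y => gram p y a b) (extChartAt (𝓡 2) p q), ← e0, ← e1]
    ring
  -- In the sum of these two instances all derivatives cancel except `∂_l g_ij`.
  have h1 := lower j l i
  have h2 := lower i l j
  simp only [gram_comm p _ j i] at h1 h2 ⊢
  rw [Finset.sum_add_distrib, h2]
  simp only [gram_comm p _ _ j]
  rw [h1]
  simp only [gram_comm p _ j i, gram_comm p _ l i, gram_comm p _ l j]
  ring

variable [IsContMDiffRiemannianBundle (𝓡 2) ∞ (EuclideanSpace ℝ (Fin 2))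
    (fun x : M => TangentSpace (𝓡 2) x)]

/-- Along the inverse chart the coordinate fields are smooth maps into the tangent bundle, and the
bundle metric of two such maps is smooth. -/
theorem contDiffAt_gram {p q : M} (hq : q ∈ (chartAt (EuclideanSpace ℝ (Fin 2)) p).source)
    (i j : Fin 2) : ContDiffAt ℝ ∞ (fun x => gram p x i j) (extChartAt (𝓡 2) p q) := by
  have ht : extChartAt (𝓡 2) p q ∈ (extChartAt (𝓡 2) p).target :=
    (extChartAt (𝓡 2) p).map_source (by rwa [extChartAt_source])
  have hopen : IsOpen (extChartAt (𝓡 2) p).target := isOpen_extChartAt_target p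
  have hsec : ∀ v : EuclideanSpace ℝ (Fin 2), ContMDiffOn 𝓘(ℝ, EuclideanSpace ℝ (Fin 2))
      (𝓡 2).tangent ∞ (fun x => (⟨(extChartAt (𝓡 2) p).symm x,
        ofCoord p ((extChartAt (𝓡 2) p).symm x) v⟩ : TangentBundle (𝓡 2) M))
      (extChartAt (𝓡 2) p).target := by
    intro v
    have hmem : ∀ x ∈ (extChartAt (𝓡 2) p).target, (extChartAt (𝓡 2) p).symm x ∈
        (trivializationAt (EuclideanSpace ℝ (Fin 2))
          (fun x : M => TangentSpace (𝓡 2) x) p).baseSet := fun x hx => by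
      have := (extChartAt (𝓡 2) p).map_target hx
      rw [extChartAt_source] at this
      exact this
    have h1 := Trivialization.contMDiffOn_symm (n := ∞) (𝕜 := ℝ) (IB := 𝓡 2)
      (trivializationAt (EuclideanSpace ℝ (Fin 2)) (fun x : M => TangentSpace (𝓡 2) x) p)
    have h2 : ContMDiffOn 𝓘(ℝ, EuclideanSpace ℝ (Fin 2))
        ((𝓡 2).prod 𝓘(ℝ, EuclideanSpace ℝ (Fin 2))) ∞
        (fun x => ((extChartAt (𝓡 2) p).symm x, v)) (extChartAt (𝓡 2) p).target :=
      (contMDiffOn_extChartAt_symm p).prodMk contMDiffOn_const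
    refine (h1.comp h2 fun x hx => ?_).congr fun x hx => ?_
    · exact (trivializationAt (EuclideanSpace ℝ (Fin 2))
        (fun x : M => TangentSpace (𝓡 2) x) p).mem_target.2 (hmem x hx)
    · rw [ofCoord, Trivialization.symmL_apply _ (hmem x hx)]
      exact Trivialization.mk_symm _ (hmem x hx) v
  have h3 := ContMDiffWithinAt.inner_bundle (n := ∞) (IB := 𝓡 2)
    (hsec (EuclideanSpace.single i 1) _ ht) (hsec (EuclideanSpace.single j 1) _ ht)
  exact (contMDiffWithinAt_iff_contDiffWithinAt.1 h3).contDiffAt (hopen.mem_nhds ht)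

theorem contDiffAt_gram_inv {p q : M}
    (hq : q ∈ (chartAt (EuclideanSpace ℝ (Fin 2)) p).source) (i j : Fin 2) :
    ContDiffAt ℝ ∞ (fun x => (gram p x)⁻¹ i j) (extChartAt (𝓡 2) p q) := by
  have hg := fun a b => contDiffAt_gram (p := p) hq a b
  have h0 := (isUnit_det_gram hq).ne_zero
  simp only [Matrix.inv_def, Matrix.det_fin_two, Ring.inverse_eq_inv', Matrix.smul_apply,
    smul_eq_mul, Matrix.adjugate_fin_two] at h0 ⊢
  refine ContDiffAt.mul (ContDiffAt.inv (by fun_prop) h0) ?_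
  fin_cases i <;> fin_cases j <;> simp <;> fun_prop

theorem contDiffAt_pderiv {f : EuclideanSpace ℝ (Fin 2) → ℝ} {x : EuclideanSpace ℝ (Fin 2)}
    (hf : ContDiffAt ℝ ∞ f x) (i : Fin 2) : ContDiffAt ℝ ∞ (pderiv i f) x :=
  (hf.fderiv_right (m := ∞) (by simp)).clm_apply contDiffAt_const

theorem contDiffAt_christoffel {p q : M}
    (hq : q ∈ (chartAt (EuclideanSpace ℝ (Fin 2)) p).source) (k i j : Fin 2) :
    ContDiffAt ℝ ∞ (christoffel p k i j) (extChartAt (𝓡 2) p q) := by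
  unfold christoffel
  refine contDiffAt_const.mul (ContDiffAt.sum fun l _ => (contDiffAt_gram_inv hq k l).mul ?_)
  exact ((contDiffAt_pderiv (contDiffAt_gram hq _ _) _).add
    (contDiffAt_pderiv (contDiffAt_gram hq _ _) _)).sub
    (contDiffAt_pderiv (contDiffAt_gram hq _ _) _)

end Charts

section CovariantDerivative

variable {M : Type*} [TopologicalSpace M] [ChartedSpace (EuclideanSpace ℝ (Fin 2)) M]
  [IsManifold (𝓡 2) ∞ M] [RiemannianBundle (fun x : M => TangentSpace (𝓡 2) x)]

/-! ### The covariant derivative along a curve, computed in a chart -/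

/-- The chain rule is put in components so that the tensor identities below become polynomial
identities in partial derivatives. -/
theorem hasDerivWithinAt_comp_components {F : EuclideanSpace ℝ (Fin 2) → ℝ}
    {x : ℝ → EuclideanSpace ℝ (Fin 2)} {x' : Fin 2 → ℝ} {S : Set ℝ} {u : ℝ}
    (hF : DifferentiableAt ℝ F (x u)) (hx : ∀ k, HasDerivWithinAt (fun r => x r k) (x' k) S u) :
    HasDerivWithinAt (fun r => F (x r)) (∑ l, pderiv l F (x u) * x' l) S u := by
  have hv : HasDerivWithinAt x (∑ l, x' l • EuclideanSpace.single l (1 : ℝ)) S u := by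
    have h1 : HasDerivWithinAt (fun r => ∑ l, x r l • EuclideanSpace.single l (1 : ℝ))
        (∑ l, x' l • EuclideanSpace.single l (1 : ℝ)) S u :=
      HasDerivWithinAt.fun_sum fun l _ => (hx l).smul_const _
    have e : ∀ r, x r = ∑ l, x r l • EuclideanSpace.single l (1 : ℝ) := fun r => by
      ext k
      fin_cases k <;> simp
    exact h1.congr_of_eventuallyEq (.of_forall e) (e u)
  refine (hF.hasFDerivAt.comp_hasDerivWithinAt u hv).congr_deriv ?_
  simp [pderiv, mul_comm]

variable {p : M} {S : Set ℝ} {γ : ℝ → M} {V W : (u : ℝ) → TangentSpace (𝓡 2) (γ u)} {u : ℝ}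

theorem coord_covDerivInChart
    (hq : γ u ∈ (chartAt (EuclideanSpace ℝ (Fin 2)) p).source) (k : Fin 2) :
    coord p (covDerivInChart p S γ V u) k = derivWithin (fun r => coord p (V r) k) S u
      + ∑ i, ∑ j, christoffel p k i j (extChartAt (𝓡 2) p (γ u))
          * derivWithin (fun r => extChartAt (𝓡 2) p (γ r) i) S u * coord p (V u) j := by
  rw [covDerivInChart, coord_ofCoord hq]

/-- Only the germ of the field within the parameter set matters; formulas valid near a point may be
substituted under the derivative. -/
theorem covDerivInChart_congr (hu : u ∈ S)
    (h : ∀ᶠ r in nhdsWithin u S, V r = W r) :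
    covDerivInChart p S γ V u = covDerivInChart p S γ W u := by
  have h0 := h.self_of_nhdsWithin hu
  unfold covDerivInChart
  rw [h0]
  congr 2
  funext k
  congr 1
  exact Filter.EventuallyEq.derivWithin_eq (h.mono fun r hr => congrArg (coord p · k) hr)
    (congrArg (coord p · k) h0)

theorem covDerivInChart_smul (hq : γ u ∈ (chartAt (EuclideanSpace ℝ (Fin 2)) p).source)
    {f : ℝ → ℝ} (hf : DifferentiableWithinAt ℝ f S u)
    (hV : ∀ k, DifferentiableWithinAt ℝ (fun r => coord p (V r) k) S u) :
    covDerivInChart p S γ (fun r => f r • V r) u =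
      derivWithin f S u • V u + f u • covDerivInChart p S γ V u := by
  refine coord_injective hq fun k => ?_
  simp only [coord_add, coord_smul, coord_covDerivInChart hq, PiLp.add_apply, PiLp.smul_apply,
    smul_eq_mul]
  rw [derivWithin_fun_mul hf (hV k)]
  simp only [mul_add, Fin.sum_univ_two]
  ring

variable [IsContMDiffRiemannianBundle (𝓡 2) ∞ (EuclideanSpace ℝ (Fin 2))
    (fun x : M => TangentSpace (𝓡 2) x)]

/-- The covariant derivative is compatible with the metric. -/
theorem hasDerivWithinAt_inner (hu : u ∈ S)
    (hq : ∀ᶠ r in nhdsWithin u S, γ r ∈ (chartAt (EuclideanSpace ℝ (Fin 2)) p).source)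
    (hγ : ∀ k, DifferentiableWithinAt ℝ (fun r => extChartAt (𝓡 2) p (γ r) k) S u)
    (hV : ∀ k, DifferentiableWithinAt ℝ (fun r => coord p (V r) k) S u)
    (hW : ∀ k, DifferentiableWithinAt ℝ (fun r => coord p (W r) k) S u) :
    HasDerivWithinAt (fun r => (inner ℝ (V r) (W r) : ℝ))
      (inner ℝ (covDerivInChart p S γ V u) (W u)
        + inner ℝ (V u) (covDerivInChart p S γ W u)) S u := by
  have hq0 := hq.self_of_nhdsWithin hu
  have hg : ∀ i j, HasDerivWithinAt (fun r => gram p (extChartAt (𝓡 2) p (γ r)) i j)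
      (∑ l, pderiv l (fun y => gram p y i j) (extChartAt (𝓡 2) p (γ u)) *
        derivWithin (fun r => extChartAt (𝓡 2) p (γ r) l) S u) S u := fun i j =>
    hasDerivWithinAt_comp_components (F := fun y => gram p y i j)
      ((contDiffAt_gram hq0 i j).differentiableAt (by simp)) fun k => (hγ k).hasDerivWithinAt
  have h1 : HasDerivWithinAt (fun r => ∑ i, ∑ j, gram p (extChartAt (𝓡 2) p (γ r)) i j *
      coord p (V r) i * coord p (W r) j) _ S u :=
    HasDerivWithinAt.fun_sum fun i _ => HasDerivWithinAt.fun_sum fun j _ =>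
      ((hg i j).fun_mul (hV i).hasDerivWithinAt).fun_mul (hW j).hasDerivWithinAt
  have h2 := h1.congr_of_eventuallyEq (f₁ := fun r => (inner ℝ (V r) (W r) : ℝ))
    -- Near `u` the inner product is its expression in the one chart at `p`; after differentiation,
    -- `pderiv_gram` trades derivatives of the metric for Christoffel symbols.
    (hq.mono fun r hr => inner_eq_sum hr _ _) (inner_eq_sum hq0 _ _)
  refine h2.congr_deriv ?_
  rw [inner_eq_sum hq0, inner_eq_sum hq0]
  simp only [coord_covDerivInChart hq0, pderiv_gram hq0, Fin.sum_univ_two]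
  simp only [gram_comm p _ 1 0]
  ring

end CovariantDerivative

/-! ### Paths of curves in a chart -/

section Paths

variable {M : Type*} [TopologicalSpace M] [ChartedSpace (EuclideanSpace ℝ (Fin 2)) M]

/-- The components of a path of curves in the chart centred at `p`. -/
noncomputable abbrev pathCoord (p : M) (c : ℝ → ℝ → M) (k : Fin 2) (s t : ℝ) : ℝ :=
  extChartAt (𝓡 2) p (c s t) k

variable {D : ParamDomain} {c : ℝ → ℝ → M} {p : M} {s t : ℝ}

namespace IsCurvePath

theorem eventually_mem_source (hc : IsCurvePath D c) (hs : s ∈ Icc (0 : ℝ) 1)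
    (ht : t ∈ D.carrier) (hq : c s t ∈ (chartAt (EuclideanSpace ℝ (Fin 2)) p).source) :
    ∀ᶠ q in nhdsWithin (s, t) D.strip,
      c q.1 q.2 ∈ (chartAt (EuclideanSpace ℝ (Fin 2)) p).source :=
  (hc.smooth (s, t) ⟨hs, ht⟩).continuousWithinAt.eventually
    ((chartAt (EuclideanSpace ℝ (Fin 2)) p).open_source.mem_nhds hq)

theorem mdifferentiableWithinAt_right (hc : IsCurvePath D c) (hs : s ∈ Icc (0 : ℝ) 1)
    (ht : t ∈ D.carrier) : MDifferentiableWithinAt 𝓘(ℝ, ℝ) (𝓡 2) (c s) D.carrier t := by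
  have h1 : ContMDiffOn 𝓘(ℝ, ℝ) 𝓘(ℝ, ℝ × ℝ) ∞ (fun r : ℝ => (s, r)) D.carrier :=
    (contDiff_const.prodMk contDiff_id).contMDiff.contMDiffOn
  exact ((hc.smooth.comp h1 fun r hr => ⟨hs, hr⟩) t ht).mdifferentiableWithinAt (by simp)

theorem mdifferentiableWithinAt_left (hc : IsCurvePath D c) (hs : s ∈ Icc (0 : ℝ) 1)
    (ht : t ∈ D.carrier) :
    MDifferentiableWithinAt 𝓘(ℝ, ℝ) (𝓡 2) (fun r => c r t) (Icc 0 1) s := by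
  have h1 : ContMDiffOn 𝓘(ℝ, ℝ) 𝓘(ℝ, ℝ × ℝ) ∞ (fun r : ℝ => (r, t)) (Icc 0 1) :=
    (contDiff_id.prodMk contDiff_const).contMDiff.contMDiffOn
  exact ((hc.smooth.comp h1 fun r hr => ⟨hr, ht⟩) s hs).mdifferentiableWithinAt (by simp)

end IsCurvePath

variable [IsManifold (𝓡 2) ∞ M]

/-- The components of a vector field along a path of curves in the chart centred at `p`. -/
noncomputable abbrev fieldCoord (p : M) {c : ℝ → ℝ → M}
    (V : (s t : ℝ) → TangentSpace (𝓡 2) (c s t)) (k : Fin 2) (s t : ℝ) : ℝ :=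
  coord p (V s t) k

/-- The components of the field `V` are smooth at `(s, t)`. -/
def SmoothFieldAt (D : ParamDomain) (p : M) {c : ℝ → ℝ → M}
    (V : (s t : ℝ) → TangentSpace (𝓡 2) (c s t)) (s t : ℝ) : Prop :=
  ∀ k, SmoothAt D (fieldCoord p V k) s t

variable {V W : (s t : ℝ) → TangentSpace (𝓡 2) (c s t)}

namespace IsCurvePath

theorem contDiffWithinAt_extChartAt (hc : IsCurvePath D c) (hs : s ∈ Icc (0 : ℝ) 1)
    (ht : t ∈ D.carrier) (hq : c s t ∈ (chartAt (EuclideanSpace ℝ (Fin 2)) p).source) :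
    ContDiffWithinAt ℝ ∞ (fun q : ℝ × ℝ => extChartAt (𝓡 2) p (c q.1 q.2)) D.strip (s, t) := by
  have h1 := (contMDiffAt_extChartAt' (I := 𝓡 2) (n := ∞) hq).comp_contMDiffWithinAt
    (f := fun q : ℝ × ℝ => c q.1 q.2) (s, t) (hc.smooth (s, t) ⟨hs, ht⟩)
  exact contMDiffWithinAt_iff_contDiffWithinAt.1 h1

theorem smoothAt_comp (hc : IsCurvePath D c) (hs : s ∈ Icc (0 : ℝ) 1)
    (ht : t ∈ D.carrier) (hq : c s t ∈ (chartAt (EuclideanSpace ℝ (Fin 2)) p).source)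
    {F : EuclideanSpace ℝ (Fin 2) → ℝ} (hF : ContDiffAt ℝ ∞ F (extChartAt (𝓡 2) p (c s t))) :
    SmoothAt D (fun a b => F (extChartAt (𝓡 2) p (c a b))) s t :=
  ContDiffAt.comp_contDiffWithinAt (g := F) (s, t) hF (hc.contDiffWithinAt_extChartAt hs ht hq)

theorem smoothAt_pathCoord (hc : IsCurvePath D c) (hs : s ∈ Icc (0 : ℝ) 1)
    (ht : t ∈ D.carrier) (hq : c s t ∈ (chartAt (EuclideanSpace ℝ (Fin 2)) p).source)
    (k : Fin 2) : SmoothAt D (pathCoord p c k) s t :=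
  hc.smoothAt_comp hs ht hq (F := fun x => x k)
    (EuclideanSpace.proj (𝕜 := ℝ) k).contDiff.contDiffAt

theorem coord_velocity (hc : IsCurvePath D c) (hs : s ∈ Icc (0 : ℝ) 1)
    (ht : t ∈ D.carrier) (hq : c s t ∈ (chartAt (EuclideanSpace ℝ (Fin 2)) p).source)
    (k : Fin 2) : coord p (velocity D (c s) t) k = curveDeriv D (pathCoord p c k) s t :=
  ((coord_mfderivWithin hq (D.uniqueDiffOn_carrier t ht)
    (hc.mdifferentiableWithinAt_right hs ht) k).derivWithin (D.uniqueDiffOn_carrier t ht)).symm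

theorem coord_pathVelocity (hc : IsCurvePath D c) (hs : s ∈ Icc (0 : ℝ) 1)
    (ht : t ∈ D.carrier) (hq : c s t ∈ (chartAt (EuclideanSpace ℝ (Fin 2)) p).source)
    (k : Fin 2) : coord p (pathVelocity c s t) k = pathDeriv (pathCoord p c k) s t :=
  ((coord_mfderivWithin (γ := fun r => c r t) hq (uniqueDiffOn_Icc zero_lt_one s hs)
    (hc.mdifferentiableWithinAt_left hs ht) k).derivWithin
      (uniqueDiffOn_Icc zero_lt_one s hs)).symm

theorem smoothFieldAt_velocity (hc : IsCurvePath D c) (hs : s ∈ Icc (0 : ℝ) 1)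
    (ht : t ∈ D.carrier) (hq : c s t ∈ (chartAt (EuclideanSpace ℝ (Fin 2)) p).source) :
    SmoothFieldAt D p (fun a b => velocity D (c a) b) s t := fun k => by
  refine ((hc.smoothAt_pathCoord hs ht hq k).curveDeriv hs ht).congr_of_eventuallyEq ⟨hs, ht⟩ ?_
  filter_upwards [hc.eventually_mem_source hs ht hq, self_mem_nhdsWithin] with q h1 h2
  exact hc.coord_velocity h2.1 h2.2 h1 k

theorem smoothFieldAt_pathVelocity (hc : IsCurvePath D c) (hs : s ∈ Icc (0 : ℝ) 1)
    (ht : t ∈ D.carrier) (hq : c s t ∈ (chartAt (EuclideanSpace ℝ (Fin 2)) p).source) :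
    SmoothFieldAt D p (pathVelocity c) s t := fun k => by
  refine ((hc.smoothAt_pathCoord hs ht hq k).pathDeriv hs ht).congr_of_eventuallyEq ⟨hs, ht⟩ ?_
  filter_upwards [hc.eventually_mem_source hs ht hq, self_mem_nhdsWithin] with q h1 h2
  exact hc.coord_pathVelocity h2.1 h2.2 h1 k

end IsCurvePath

/-- Smoothness into the tangent bundle is tested in the trivialization at `p`, whose fibre part
consists of the components. -/
theorem smoothFieldAt_of_contMDiffWithinAt
    (hq : c s t ∈ (chartAt (EuclideanSpace ℝ (Fin 2)) p).source)
    (hev : ∀ᶠ q in nhdsWithin (s, t) D.strip,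
      c q.1 q.2 ∈ (chartAt (EuclideanSpace ℝ (Fin 2)) p).source) (hst : (s, t) ∈ D.strip)
    (hV : ContMDiffWithinAt 𝓘(ℝ, ℝ × ℝ) (𝓡 2).tangent ∞
      (fun q : ℝ × ℝ => (⟨c q.1 q.2, V q.1 q.2⟩ : TangentBundle (𝓡 2) M)) D.strip (s, t)) :
    SmoothFieldAt D p V s t := fun k => by
  have h1 := ((trivializationAt (EuclideanSpace ℝ (Fin 2))
    (fun x : M => TangentSpace (𝓡 2) x) p).contMDiffWithinAt_iff (IB := 𝓡 2) (n := ∞)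
      (f := fun q : ℝ × ℝ => (⟨c q.1 q.2, V q.1 q.2⟩ : TangentBundle (𝓡 2) M))
      (x₀ := (s, t)) ((Trivialization.mem_source _).2 hq)).1 hV
  have h2 := contMDiffWithinAt_iff_contDiffWithinAt.1 h1.2
  have h3 : SmoothAt D (fun a b => (trivializationAt (EuclideanSpace ℝ (Fin 2))
    (fun x : M => TangentSpace (𝓡 2) x) p ⟨c a b, V a b⟩).2 k) s t :=
    (EuclideanSpace.proj (𝕜 := ℝ) k).contDiff.contDiffAt.comp_contDiffWithinAt (s, t) h2
  refine h3.congr_of_eventuallyEq hst (hev.mono fun q hq => ?_)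
  exact congrArg (fun x : EuclideanSpace ℝ (Fin 2) => x k) (coord_eq_trivialization hq _)

theorem SmoothFieldAt.smul {f : ℝ → ℝ → ℝ} (hf : SmoothAt D f s t)
    (hV : SmoothFieldAt D p V s t) : SmoothFieldAt D p (fun a b => f a b • V a b) s t := fun k => by
  unfold fieldCoord
  simp only [coord_smul, PiLp.smul_apply, smul_eq_mul]
  exact hf.mul (hV k)

theorem SmoothFieldAt.differentiable_right (hV : SmoothFieldAt D p V s t)
    (hs : s ∈ Icc (0 : ℝ) 1) (k : Fin 2) :
    DifferentiableWithinAt ℝ (fun r => coord p (V s r) k) D.carrier t :=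
  ((hV k).hasDerivWithinAt_right hs).differentiableWithinAt

theorem SmoothFieldAt.differentiable_left (hV : SmoothFieldAt D p V s t)
    (ht : t ∈ D.carrier) (k : Fin 2) :
    DifferentiableWithinAt ℝ (fun r => coord p (V r t) k) (Icc 0 1) s :=
  ((hV k).hasDerivWithinAt_left ht).differentiableWithinAt

variable [RiemannianBundle (fun x : M => TangentSpace (𝓡 2) x)]

/-- The connection is torsion free. -/
theorem IsCurvePath.covDerivInChart_velocity (hc : IsCurvePath D c) (hs : s ∈ Icc (0 : ℝ) 1)
    (ht : t ∈ D.carrier) (hq : c s t ∈ (chartAt (EuclideanSpace ℝ (Fin 2)) p).source) :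
    covDerivInChart p (Icc 0 1) (fun r => c r t) (fun r => velocity D (c r) t) s =
      covDerivInChart p D.carrier (c s) (pathVelocity c s) t := by
  have hev := hc.eventually_mem_source hs ht hq
  refine coord_injective hq fun k => ?_
  rw [coord_covDerivInChart (γ := fun r => c r t) hq, coord_covDerivInChart hq]
  have e1 : derivWithin (fun r => coord p (velocity D (c r) t) k) (Icc 0 1) s =
      pathDeriv (curveDeriv D (pathCoord p c k)) s t := by
    refine pathDeriv_congr (f := fun a b => coord p (velocity D (c a) b) k) ht hs ?_
    filter_upwards [hev, self_mem_nhdsWithin] with q h1 h2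
    exact hc.coord_velocity h2.1 h2.2 h1 k
  have e2 : derivWithin (fun r => coord p (pathVelocity c s r) k) D.carrier t =
      curveDeriv D (pathDeriv (pathCoord p c k)) s t := by
    refine curveDeriv_congr (f := fun a b => coord p (pathVelocity c a b) k) ht hs ?_
    filter_upwards [hev, self_mem_nhdsWithin] with q h1 h2
    exact hc.coord_pathVelocity h2.1 h2.2 h1 k
  -- The second-order parts agree as mixed partials; the quadratic remainders agree by the symmetry
  -- of the Christoffel symbols.
  rw [e1, e2, (hc.smoothAt_pathCoord hs ht hq k).pathDeriv_curveDeriv hs ht]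
  congr 1
  simp only [hc.coord_velocity hs ht hq, hc.coord_pathVelocity hs ht hq, pathDeriv, curveDeriv,
    Fin.sum_univ_two, christoffel_comm p k 1 0]
  ring

variable [IsContMDiffRiemannianBundle (𝓡 2) ∞ (EuclideanSpace ℝ (Fin 2))
    (fun x : M => TangentSpace (𝓡 2) x)]

theorem SmoothFieldAt.inner (hc : IsCurvePath D c) (hs : s ∈ Icc (0 : ℝ) 1)
    (ht : t ∈ D.carrier) (hq : c s t ∈ (chartAt (EuclideanSpace ℝ (Fin 2)) p).source)
    (hV : SmoothFieldAt D p V s t) (hW : SmoothFieldAt D p W s t) :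
    SmoothAt D (fun a b => inner ℝ (V a b) (W a b)) s t := by
  have h1 : SmoothAt D (fun a b => ∑ i, ∑ j, gram p (extChartAt (𝓡 2) p (c a b)) i j *
      coord p (V a b) i * coord p (W a b) j) s t :=
    SmoothAt.sum fun i _ => SmoothAt.sum fun j _ =>
      ((hc.smoothAt_comp hs ht hq (contDiffAt_gram hq i j)).mul (hV i)).mul (hW j)
  exact h1.congr_of_eventuallyEq ⟨hs, ht⟩
    ((hc.eventually_mem_source hs ht hq).mono fun q hq => inner_eq_sum hq _ _)

/-- Covariant derivatives in the two directions commute up to the curvature. -/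
theorem IsCurvePath.covDerivInChart_comm (hc : IsCurvePath D c) (hs : s ∈ Icc (0 : ℝ) 1)
    (ht : t ∈ D.carrier) (hV : SmoothFieldAt D (c s t) V s t) :
    SurfaceCurves.covDerivInChart (c s t) (Icc 0 1) (fun r => c r t) (fun r =>
        SurfaceCurves.covDerivInChart (c s t) D.carrier (c r) (V r) t) s =
      SurfaceCurves.covDerivInChart (c s t) D.carrier (c s) (fun b =>
        SurfaceCurves.covDerivInChart (c s t) (Icc 0 1) (fun r => c r b) (fun r => V r b) s) t
      + curvatureTensor (c s t) (pathVelocity c s t) (velocity D (c s) t) (V s t) := by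
  have hq : c s t ∈ (chartAt (EuclideanSpace ℝ (Fin 2)) (c s t)).source := mem_chart_source _ _
  set p := c s t with hp
  have hev := hc.eventually_mem_source hs ht hq
  have huI := uniqueDiffOn_Icc (zero_lt_one (α := ℝ)) s hs
  have huC := D.uniqueDiffOn_carrier t ht
  have hx := hc.smoothAt_pathCoord hs ht hq
  have hΓ := fun k i j => (contDiffAt_christoffel (p := p) hq k i j).differentiableAt (by simp)
  refine coord_injective hq fun k => ?_
  rw [coord_add, PiLp.add_apply, curvatureTensor, coord_ofCoord hq,
    coord_covDerivInChart (γ := fun r => c r t) hq, coord_covDerivInChart hq]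
  -- Both inner derivatives are taken in the fixed chart at `p`, including at neighbouring points,
  -- so their components can be differentiated by the product and chain rules.
  have e1 : derivWithin (fun r => coord p
      (SurfaceCurves.covDerivInChart p D.carrier (c r) (V r) t) k) (Icc 0 1) s =
      pathDeriv (curveDeriv D (fieldCoord p V k)) s t +
      ∑ i, ∑ j, (((∑ l, pderiv l (christoffel p k i j) (extChartAt (𝓡 2) p (c s t)) *
          pathDeriv (pathCoord p c l) s t) * curveDeriv D (pathCoord p c i) s t
        + christoffel p k i j (extChartAt (𝓡 2) p (c s t)) *
          pathDeriv (curveDeriv D (pathCoord p c i)) s t) * fieldCoord p V j s t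
        + christoffel p k i j (extChartAt (𝓡 2) p (c s t)) *
          curveDeriv D (pathCoord p c i) s t * pathDeriv (fieldCoord p V j) s t) := by
    have h1 := (((hV k).curveDeriv hs ht).hasDerivWithinAt_left ht).fun_add
      (HasDerivWithinAt.fun_sum (u := Finset.univ) fun i _ =>
        HasDerivWithinAt.fun_sum (u := Finset.univ) fun j _ =>
        ((hasDerivWithinAt_comp_components (hΓ k i j)
          fun l => (hx l).hasDerivWithinAt_left ht).fun_mul
          (((hx i).curveDeriv hs ht).hasDerivWithinAt_left ht)).fun_mul
          ((hV j).hasDerivWithinAt_left ht))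
    rw [← h1.derivWithin huI]
    exact Filter.EventuallyEq.derivWithin_eq
      ((eventually_strip_left
        (P := fun a b => c a b ∈ (chartAt (EuclideanSpace ℝ (Fin 2)) p).source) ht hev).mono
        fun r hr => coord_covDerivInChart hr k) (coord_covDerivInChart hq k)
  have e2 : derivWithin (fun b => coord p
      (SurfaceCurves.covDerivInChart p (Icc 0 1) (fun r => c r b) (fun r => V r b) s) k)
        D.carrier t =
      curveDeriv D (pathDeriv (fieldCoord p V k)) s t +
      ∑ i, ∑ j, (((∑ l, pderiv l (christoffel p k i j) (extChartAt (𝓡 2) p (c s t)) *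
          curveDeriv D (pathCoord p c l) s t) * pathDeriv (pathCoord p c i) s t
        + christoffel p k i j (extChartAt (𝓡 2) p (c s t)) *
          curveDeriv D (pathDeriv (pathCoord p c i)) s t) * fieldCoord p V j s t
        + christoffel p k i j (extChartAt (𝓡 2) p (c s t)) *
          pathDeriv (pathCoord p c i) s t * curveDeriv D (fieldCoord p V j) s t) := by
    have h1 := (((hV k).pathDeriv hs ht).hasDerivWithinAt_right hs).fun_add
      (HasDerivWithinAt.fun_sum (u := Finset.univ) fun i _ =>
        HasDerivWithinAt.fun_sum (u := Finset.univ) fun j _ =>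
        ((hasDerivWithinAt_comp_components (hΓ k i j)
          fun l => (hx l).hasDerivWithinAt_right hs).fun_mul
          (((hx i).pathDeriv hs ht).hasDerivWithinAt_right hs)).fun_mul
          ((hV j).hasDerivWithinAt_right hs))
    rw [← h1.derivWithin huC]
    exact Filter.EventuallyEq.derivWithin_eq
      ((eventually_strip_right
        (P := fun a b => c a b ∈ (chartAt (EuclideanSpace ℝ (Fin 2)) p).source) hs hev).mono
        fun r hr => coord_covDerivInChart (γ := fun a => c a r) hr k)
      (coord_covDerivInChart (γ := fun a => c a t) hq k)
  -- Once the mixed partials of the field and of the path are identified, they cancel, and the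
  -- remaining terms are those defining `riemann`.
  rw [e1, e2, (hV k).pathDeriv_curveDeriv hs ht]
  simp only [(hx _).pathDeriv_curveDeriv hs ht]
  have f1 : ∀ j, coord p (SurfaceCurves.covDerivInChart p D.carrier (c s) (V s) t) j =
      curveDeriv D (fieldCoord p V j) s t + ∑ a, ∑ b,
        christoffel p j a b (extChartAt (𝓡 2) p (c s t)) * curveDeriv D (pathCoord p c a) s t *
          fieldCoord p V b s t := fun j => coord_covDerivInChart hq j
  have f2 : ∀ j, coord p (SurfaceCurves.covDerivInChart p (Icc 0 1) (fun r => c r t)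
      (fun r => V r t) s) j =
      pathDeriv (fieldCoord p V j) s t + ∑ a, ∑ b,
        christoffel p j a b (extChartAt (𝓡 2) p (c s t)) * pathDeriv (pathCoord p c a) s t *
          fieldCoord p V b s t := fun j => coord_covDerivInChart (γ := fun r => c r t) hq j
  simp only [f1, f2, hc.coord_velocity hs ht hq, hc.coord_pathVelocity hs ht hq, riemann]
  change _ + ∑ i, ∑ j, _ * pathDeriv (pathCoord p c i) s t * _ =
    _ + ∑ i, ∑ j, _ * curveDeriv D (pathCoord p c i) s t * _ + _
  rw [← hp]
  generalize extChartAt (𝓡 2) p p = x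
  simp only [Fin.sum_univ_two]
  ring

end Paths

/-! ### The structure equations of a normal path -/

theorem eq_add_of_orthonormal {E : Type*} [NormedAddCommGroup E] [InnerProductSpace ℝ E]
    (hE : Module.finrank ℝ E = 2) {a b : E} (ha : inner ℝ a a = (1 : ℝ))
    (hb : inner ℝ b b = (1 : ℝ)) (hab : inner ℝ a b = (0 : ℝ)) (v : E) :
    v = (inner ℝ v a : ℝ) • a + (inner ℝ v b : ℝ) • b := by
  have hon : Orthonormal ℝ ![a, b] := by
    rw [orthonormal_iff_ite]
    intro i j
    fin_cases i <;> fin_cases j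
    · simpa using ha
    · simpa using hab
    · simpa [real_inner_comm] using hab
    · simpa using hb
  have hfin : FiniteDimensional ℝ E := Module.finite_of_finrank_eq_succ hE
  have hspan : ⊤ ≤ Submodule.span ℝ (range ![a, b]) := by
    rw [hon.linearIndependent.span_eq_top_of_card_eq_finrank (by simp [hE])]
  have h := (OrthonormalBasis.mk hon hspan).sum_repr' v
  simpa [Fin.sum_univ_two, real_inner_comm] using h.symm

section Frame

variable {M : Type*} [TopologicalSpace M] [ChartedSpace (EuclideanSpace ℝ (Fin 2)) M]
  [IsManifold (𝓡 2) ∞ M] [RiemannianBundle (fun x : M => TangentSpace (𝓡 2) x)]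

theorem tangent_eq_add_of_orthonormal {q : M} {a b : TangentSpace (𝓡 2) q}
    (ha : inner ℝ a a = (1 : ℝ)) (hb : inner ℝ b b = (1 : ℝ)) (hab : inner ℝ a b = (0 : ℝ))
    (v : TangentSpace (𝓡 2) q) : v = (inner ℝ v a : ℝ) • a + (inner ℝ v b : ℝ) • b :=
  eq_add_of_orthonormal (E := TangentSpace (𝓡 2) q)
    (show Module.finrank ℝ (EuclideanSpace ℝ (Fin 2)) = 2 by simp) ha hb hab v

/-- Applied to `c' = ρN` and `ċ = ωT`, this produces the factor `ρω` in front of the sectional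
curvature. -/
theorem curvatureTensor_smul_smul (p : M) (a b : ℝ) (u v w : TangentSpace (𝓡 2) p) :
    curvatureTensor p (a • u) (b • v) w = (a * b) • curvatureTensor p u v w := by
  rw [curvatureTensor, curvatureTensor, ← ofCoord_smul]
  congr 1
  ext l
  simp only [coord_smul, PiLp.smul_apply, smul_eq_mul, Fin.sum_univ_two]
  ring

variable [IsContMDiffRiemannianBundle (𝓡 2) ∞ (EuclideanSpace ℝ (Fin 2))
    (fun x : M => TangentSpace (𝓡 2) x)]

/-- The covariant derivatives of an orthonormal frame along a curve. -/
theorem covDerivInChart_frame {p : M} {S : Set ℝ} {γ : ℝ → M}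
    {V W : (u : ℝ) → TangentSpace (𝓡 2) (γ u)} {u : ℝ} (hu : u ∈ S)
    (hS : UniqueDiffWithinAt ℝ S u)
    (hq : ∀ᶠ r in nhdsWithin u S, γ r ∈ (chartAt (EuclideanSpace ℝ (Fin 2)) p).source)
    (hγ : ∀ k, DifferentiableWithinAt ℝ (fun r => extChartAt (𝓡 2) p (γ r) k) S u)
    (hV : ∀ k, DifferentiableWithinAt ℝ (fun r => coord p (V r) k) S u)
    (hW : ∀ k, DifferentiableWithinAt ℝ (fun r => coord p (W r) k) S u)
    (hVV : ∀ r ∈ S, inner ℝ (V r) (V r) = (1 : ℝ)) (hWW : ∀ r ∈ S, inner ℝ (W r) (W r) = (1 : ℝ))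
    (hVW : ∀ r ∈ S, inner ℝ (V r) (W r) = (0 : ℝ)) :
    covDerivInChart p S γ V u = (inner ℝ (covDerivInChart p S γ V u) (W u) : ℝ) • W u ∧
    covDerivInChart p S γ W u = (-(inner ℝ (covDerivInChart p S γ V u) (W u) : ℝ)) • V u := by
  -- The three inner products of the frame are constant, so metric compatibility makes the
  -- derivative of the frame skew-symmetric.
  have key : ∀ (f : ℝ → ℝ) (a f' : ℝ), (∀ r ∈ S, f r = a) → HasDerivWithinAt f f' S u → f' = 0 :=
    fun f a f' h hf => hS.eq_deriv _ hf ((hasDerivWithinAt_const u S a).congr h (h u hu))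
  have h1 := key _ _ _ hVV (hasDerivWithinAt_inner hu hq hγ hV hV)
  have h2 := key _ _ _ hWW (hasDerivWithinAt_inner hu hq hγ hW hW)
  have h3 := key _ _ _ hVW (hasDerivWithinAt_inner hu hq hγ hV hW)
  rw [real_inner_comm (covDerivInChart p S γ V u) (V u)] at h1
  rw [real_inner_comm (covDerivInChart p S γ W u) (W u)] at h2
  rw [real_inner_comm (covDerivInChart p S γ W u) (V u)] at h3
  have h1' : (inner ℝ (covDerivInChart p S γ V u) (V u) : ℝ) = 0 := by linarith
  have h2' : (inner ℝ (covDerivInChart p S γ W u) (W u) : ℝ) = 0 := by linarith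
  constructor
  · conv_lhs => rw [tangent_eq_add_of_orthonormal (hVV u hu) (hWW u hu) (hVW u hu)
      (covDerivInChart p S γ V u), h1', zero_smul, zero_add]
  · conv_lhs => rw [tangent_eq_add_of_orthonormal (hVV u hu) (hWW u hu) (hVW u hu)
      (covDerivInChart p S γ W u), h2', zero_smul, add_zero]
    congr 1
    linarith

/-- The component `ρ` of the velocity of the path in the direction of `N`. -/
noncomputable def normalSpeed (c : ℝ → ℝ → M) (N : (s t : ℝ) → TangentSpace (𝓡 2) (c s t))
    (s t : ℝ) : ℝ := inner ℝ (pathVelocity c s t) (N s t)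

/-- A smooth normal path of immersed curves, together with a smooth unit normal field. -/
structure IsFramedNormalPath (D : ParamDomain) (c : ℝ → ℝ → M)
    (N : (s t : ℝ) → TangentSpace (𝓡 2) (c s t)) : Prop where
  path : IsCurvePath D c
  field : IsUnitNormalField D c N
  normal : IsNormalPath D c

variable {D : ParamDomain} {c : ℝ → ℝ → M} {N : (s t : ℝ) → TangentSpace (𝓡 2) (c s t)}
  {p : M} {s t : ℝ}

theorem IsCurvePath.omega_pos (hc : IsCurvePath D c) (hs : s ∈ Icc (0 : ℝ) 1)
    (ht : t ∈ D.carrier) : 0 < omega D (c s) t := norm_pos_iff.2 (hc.immersed s hs t ht)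

theorem IsCurvePath.velocity_eq (hc : IsCurvePath D c) (hs : s ∈ Icc (0 : ℝ) 1)
    (ht : t ∈ D.carrier) : velocity D (c s) t = omega D (c s) t • unitTangent D (c s) t := by
  rw [unitTangent, smul_smul, mul_inv_cancel₀ (hc.omega_pos hs ht).ne', one_smul]

theorem IsCurvePath.inner_unitTangent (hc : IsCurvePath D c) (hs : s ∈ Icc (0 : ℝ) 1)
    (ht : t ∈ D.carrier) :
    inner ℝ (unitTangent D (c s) t) (unitTangent D (c s) t) = (1 : ℝ) := by
  have h := (hc.omega_pos hs ht).ne'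
  rw [unitTangent, real_inner_smul_left, real_inner_smul_right, real_inner_self_eq_norm_sq]
  change (omega D (c s) t)⁻¹ * ((omega D (c s) t)⁻¹ * omega D (c s) t ^ 2) = 1
  field_simp

theorem IsCurvePath.smoothAt_omega (hc : IsCurvePath D c) (hs : s ∈ Icc (0 : ℝ) 1)
    (ht : t ∈ D.carrier) : SmoothAt D (fun a b => omega D (c a) b) s t := by
  have hq : c s t ∈ (chartAt (EuclideanSpace ℝ (Fin 2)) (c s t)).source := mem_chart_source _ _
  have hv := hc.smoothFieldAt_velocity hs ht hq
  have h1 := SmoothFieldAt.inner hc hs ht hq hv hv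
  have h2 : SmoothAt D (fun a b => Real.sqrt
      (inner ℝ (velocity D (c a) b) (velocity D (c a) b))) s t :=
    ContDiffWithinAt.sqrt h1 (inner_self_ne_zero.2 (hc.immersed s hs t ht))
  exact h2.congr_of_eventuallyEq ⟨hs, ht⟩ (.of_forall fun q => norm_eq_sqrt_real_inner _)

theorem IsCurvePath.smoothFieldAt_unitTangent (hc : IsCurvePath D c) (hs : s ∈ Icc (0 : ℝ) 1)
    (ht : t ∈ D.carrier) (hq : c s t ∈ (chartAt (EuclideanSpace ℝ (Fin 2)) p).source) :
    SmoothFieldAt D p (fun a b => unitTangent D (c a) b) s t :=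
  SmoothFieldAt.smul ((hc.smoothAt_omega hs ht).inv (hc.omega_pos hs ht).ne')
    (hc.smoothFieldAt_velocity hs ht hq)

namespace IsFramedNormalPath

theorem inner_normal (h : IsFramedNormalPath D c N) (hs : s ∈ Icc (0 : ℝ) 1)
    (ht : t ∈ D.carrier) : inner ℝ (unitTangent D (c s) t) (N s t) = (0 : ℝ) := by
  rw [unitTangent, real_inner_smul_left, real_inner_comm, h.field.normal s hs t ht, mul_zero]

theorem pathVelocity_eq (h : IsFramedNormalPath D c N) (hs : s ∈ Icc (0 : ℝ) 1)
    (ht : t ∈ D.carrier) : pathVelocity c s t = normalSpeed c N s t • N s t := by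
  conv_lhs => rw [tangent_eq_add_of_orthonormal (h.path.inner_unitTangent hs ht)
    (h.field.unit s hs t ht) (h.inner_normal hs ht) (pathVelocity c s t), h.normal s hs t ht,
    zero_smul, zero_add]
  rfl

theorem smoothFieldAt_normal (h : IsFramedNormalPath D c N) (hs : s ∈ Icc (0 : ℝ) 1)
    (ht : t ∈ D.carrier) (hq : c s t ∈ (chartAt (EuclideanSpace ℝ (Fin 2)) p).source) :
    SmoothFieldAt D p N s t :=
  smoothFieldAt_of_contMDiffWithinAt hq (h.path.eventually_mem_source hs ht hq) ⟨hs, ht⟩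
    (h.field.smooth (s, t) ⟨hs, ht⟩)

theorem smoothAt_normalSpeed (h : IsFramedNormalPath D c N) (hs : s ∈ Icc (0 : ℝ) 1)
    (ht : t ∈ D.carrier) : SmoothAt D (normalSpeed c N) s t :=
  have hq : c s t ∈ (chartAt (EuclideanSpace ℝ (Fin 2)) (c s t)).source := mem_chart_source _ _
  SmoothFieldAt.inner h.path hs ht hq (h.path.smoothFieldAt_pathVelocity hs ht hq)
    (h.smoothFieldAt_normal hs ht hq)

theorem frame_right (h : IsFramedNormalPath D c N) (hs : s ∈ Icc (0 : ℝ) 1)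
    (ht : t ∈ D.carrier) (hq : c s t ∈ (chartAt (EuclideanSpace ℝ (Fin 2)) p).source) :
    covDerivInChart p D.carrier (c s) (unitTangent D (c s)) t =
      (inner ℝ (covDerivInChart p D.carrier (c s) (unitTangent D (c s)) t) (N s t) : ℝ) • N s t ∧
    covDerivInChart p D.carrier (c s) (N s) t =
      (-(inner ℝ (covDerivInChart p D.carrier (c s) (unitTangent D (c s)) t) (N s t) : ℝ)) •
        unitTangent D (c s) t :=
  covDerivInChart_frame ht (D.uniqueDiffOn_carrier t ht)
    (eventually_strip_right
      (P := fun a b => c a b ∈ (chartAt (EuclideanSpace ℝ (Fin 2)) p).source) hs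
      (h.path.eventually_mem_source hs ht hq))
    (fun k => ((h.path.smoothAt_pathCoord hs ht hq k).hasDerivWithinAt_right
      hs).differentiableWithinAt)
    ((h.path.smoothFieldAt_unitTangent hs ht hq).differentiable_right hs)
    ((h.smoothFieldAt_normal hs ht hq).differentiable_right hs)
    (fun _ hr => h.path.inner_unitTangent hs hr) (fun r hr => h.field.unit s hs r hr)
    (fun _ hr => h.inner_normal hs hr)

theorem frame_left (h : IsFramedNormalPath D c N) (hs : s ∈ Icc (0 : ℝ) 1)
    (ht : t ∈ D.carrier) (hq : c s t ∈ (chartAt (EuclideanSpace ℝ (Fin 2)) p).source) :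
    covDerivInChart p (Icc 0 1) (fun r => c r t) (fun r => unitTangent D (c r) t) s =
      (inner ℝ (covDerivInChart p (Icc 0 1) (fun r => c r t) (fun r => unitTangent D (c r) t) s)
        (N s t) : ℝ) • N s t ∧
    covDerivInChart p (Icc 0 1) (fun r => c r t) (fun r => N r t) s =
      (-(inner ℝ (covDerivInChart p (Icc 0 1) (fun r => c r t)
        (fun r => unitTangent D (c r) t) s) (N s t) : ℝ)) • unitTangent D (c s) t :=
  covDerivInChart_frame (γ := fun r => c r t) hs (uniqueDiffOn_Icc zero_lt_one s hs)
    (eventually_strip_left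
      (P := fun a b => c a b ∈ (chartAt (EuclideanSpace ℝ (Fin 2)) p).source) ht
      (h.path.eventually_mem_source hs ht hq))
    (fun k => ((h.path.smoothAt_pathCoord hs ht hq k).hasDerivWithinAt_left
      ht).differentiableWithinAt)
    ((h.path.smoothFieldAt_unitTangent hs ht hq).differentiable_left ht)
    ((h.smoothFieldAt_normal hs ht hq).differentiable_left ht)
    (fun _ hr => h.path.inner_unitTangent hr ht) (fun r hr => h.field.unit r hr t ht)
    (fun _ hr => h.inner_normal hr ht)

/-- The first structure equations, in any chart. -/
theorem first_structure_equations (h : IsFramedNormalPath D c N) (hs : s ∈ Icc (0 : ℝ) 1)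
    (ht : t ∈ D.carrier) (hq : c s t ∈ (chartAt (EuclideanSpace ℝ (Fin 2)) p).source) :
    pathDeriv (fun a b => omega D (c a) b) s t = -(normalSpeed c N s t *
      inner ℝ (covDerivInChart p D.carrier (c s) (unitTangent D (c s)) t) (N s t)) ∧
    omega D (c s) t * inner ℝ (covDerivInChart p (Icc 0 1) (fun r => c r t)
      (fun r => unitTangent D (c r) t) s) (N s t) = curveDeriv D (normalSpeed c N) s t := by
  have hω := h.path.smoothAt_omega hs ht
  have hT := h.path.smoothFieldAt_unitTangent hs ht hq
  have hNs := h.smoothFieldAt_normal hs ht hq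
  -- The two sides of the torsion-free identity are expanded as `∇_s(ωT)` and `∇_t(ρN)`.
  have e1 : covDerivInChart p (Icc 0 1) (fun r => c r t) (fun r => velocity D (c r) t) s =
      pathDeriv (fun a b => omega D (c a) b) s t • unitTangent D (c s) t +
      omega D (c s) t • covDerivInChart p (Icc 0 1) (fun r => c r t)
        (fun r => unitTangent D (c r) t) s := by
    rw [covDerivInChart_congr (γ := fun r => c r t)
      (W := fun r => omega D (c r) t • unitTangent D (c r) t) hs
      (eventually_nhdsWithin_of_forall fun r hr => h.path.velocity_eq hr ht)]
    exact covDerivInChart_smul (γ := fun r => c r t) hq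
      (hω.hasDerivWithinAt_left ht).differentiableWithinAt (hT.differentiable_left ht)
  have e2 : covDerivInChart p D.carrier (c s) (pathVelocity c s) t =
      curveDeriv D (normalSpeed c N) s t • N s t +
      normalSpeed c N s t • covDerivInChart p D.carrier (c s) (N s) t := by
    rw [covDerivInChart_congr (W := fun r => normalSpeed c N s r • N s r) ht
      (eventually_nhdsWithin_of_forall fun r hr => h.pathVelocity_eq hs hr)]
    exact covDerivInChart_smul hq
      ((h.smoothAt_normalSpeed hs ht).hasDerivWithinAt_right hs).differentiableWithinAt
      (hNs.differentiable_right hs)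
  have e3 := h.path.covDerivInChart_velocity hs ht hq
  have hf := h.frame_left hs ht hq
  have hg := h.frame_right hs ht hq
  rw [e1, e2, hf.1, hg.2] at e3
  have hTT := h.path.inner_unitTangent hs ht
  have hNN := h.field.unit s hs t ht
  have hTN := h.inner_normal hs ht
  have hNT : inner ℝ (N s t) (unitTangent D (c s) t) = (0 : ℝ) := by rw [real_inner_comm, hTN]
  -- The tangential component gives `ω'`, the normal one gives `∇_s T`.
  have i1 := congrArg (fun v => (inner ℝ v (unitTangent D (c s) t) : ℝ)) e3
  have i2 := congrArg (fun v => (inner ℝ v (N s t) : ℝ)) e3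
  simp only [inner_add_left, real_inner_smul_left, hTT, hNN, hTN, hNT] at i1 i2
  constructor
  · linear_combination i1
  · linear_combination i2

end IsFramedNormalPath

end Frame

/-! ### Signed curvature in an arbitrary chart and its evolution -/

section Curvature

variable {M : Type*} [TopologicalSpace M] [ChartedSpace (EuclideanSpace ℝ (Fin 2)) M]
  [IsManifold (𝓡 2) ∞ M] [RiemannianBundle (fun x : M => TangentSpace (𝓡 2) x)]
  [IsContMDiffRiemannianBundle (𝓡 2) ∞ (EuclideanSpace ℝ (Fin 2))
    (fun x : M => TangentSpace (𝓡 2) x)]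

variable {D : ParamDomain} {c : ℝ → ℝ → M} {N : (s t : ℝ) → TangentSpace (𝓡 2) (c s t)}
  {p : M} {s t : ℝ}

theorem curvature_eq (s t : ℝ) : curvature D (c s) (N s) t = (omega D (c s) t)⁻¹ *
    inner ℝ (covDerivInChart (c s t) D.carrier (c s) (unitTangent D (c s)) t) (N s t) := by
  rw [curvature, nablaT, covDeriv, real_inner_smul_left]

namespace IsFramedNormalPath

/-- The signed curvature may be computed in any chart. -/
theorem omega_mul_curvature (h : IsFramedNormalPath D c N) (hs : s ∈ Icc (0 : ℝ) 1)
    (ht : t ∈ D.carrier) (hq : c s t ∈ (chartAt (EuclideanSpace ℝ (Fin 2)) p).source)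
    (hρ : normalSpeed c N s t ≠ 0) :
    inner ℝ (covDerivInChart p D.carrier (c s) (unitTangent D (c s)) t) (N s t) =
      omega D (c s) t * curvature D (c s) (N s) t := by
  -- The derivative of `ω` involves no chart. Comparing its expressions in the chart at `p` and in
  -- the chart at `c s t` and cancelling `ρ` gives chart independence.
  have h1 := (h.first_structure_equations hs ht hq).1
  have h2 := (h.first_structure_equations (p := c s t) hs ht (mem_chart_source _ _)).1
  rw [h1, neg_inj] at h2
  rw [curvature_eq, mul_inv_cancel_left₀ (h.path.omega_pos hs ht).ne']
  exact mul_left_cancel₀ hρ h2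

theorem pathDeriv_omega (h : IsFramedNormalPath D c N) (hs : s ∈ Icc (0 : ℝ) 1)
    (ht : t ∈ D.carrier) : pathDeriv (fun a b => omega D (c a) b) s t =
      -(normalSpeed c N s t * curvature D (c s) (N s) t * omega D (c s) t) := by
  have h0 := (h.path.omega_pos hs ht).ne'
  rw [(h.first_structure_equations (p := c s t) hs ht (mem_chart_source _ _)).1, curvature_eq]
  field_simp

/-- The chart at `p` is kept free so that the formula holds at all points near a given one in the
same chart, as a second differentiation requires. -/
theorem covDerivInChart_right (h : IsFramedNormalPath D c N) (hs : s ∈ Icc (0 : ℝ) 1)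
    (ht : t ∈ D.carrier) (hq : c s t ∈ (chartAt (EuclideanSpace ℝ (Fin 2)) p).source)
    (hρ : normalSpeed c N s t ≠ 0) :
    covDerivInChart p D.carrier (c s) (unitTangent D (c s)) t =
      (omega D (c s) t * curvature D (c s) (N s) t) • N s t ∧
    covDerivInChart p D.carrier (c s) (N s) t =
      (-(omega D (c s) t * curvature D (c s) (N s) t)) • unitTangent D (c s) t := by
  rw [← h.omega_mul_curvature hs ht hq hρ]
  exact h.frame_right hs ht hq

/-- Since `ρ_θ` refers to no chart, independence of the chart is immediate here and no condition on
`ρ` is needed. -/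
theorem covDerivInChart_left (h : IsFramedNormalPath D c N) (hs : s ∈ Icc (0 : ℝ) 1)
    (ht : t ∈ D.carrier) (hq : c s t ∈ (chartAt (EuclideanSpace ℝ (Fin 2)) p).source) :
    covDerivInChart p (Icc 0 1) (fun r => c r t) (fun r => unitTangent D (c r) t) s =
      arcDeriv D (c s) (normalSpeed c N s) t • N s t ∧
    covDerivInChart p (Icc 0 1) (fun r => c r t) (fun r => N r t) s =
      (-arcDeriv D (c s) (normalSpeed c N s) t) • unitTangent D (c s) t := by
  have e : arcDeriv D (c s) (normalSpeed c N s) t =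
      inner ℝ (covDerivInChart p (Icc 0 1) (fun r => c r t)
        (fun r => unitTangent D (c r) t) s) (N s t) := by
    have h1 := (h.first_structure_equations hs ht hq).2
    rw [arcDeriv, inv_mul_eq_iff_eq_mul₀ (h.path.omega_pos hs ht).ne', h1]
    rfl
  rw [e]
  exact h.frame_left hs ht hq

/-- The definition uses a chart that varies with the point, so smoothness is taken from `κ =
-ω'/(ρω)` instead. -/
theorem smoothAt_curvature (h : IsFramedNormalPath D c N) (hs : s ∈ Icc (0 : ℝ) 1)
    (ht : t ∈ D.carrier)
    (hρ : ∀ s ∈ Icc (0 : ℝ) 1, ∀ t ∈ D.carrier, normalSpeed c N s t ≠ 0) :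
    SmoothAt D (fun a b => curvature D (c a) (N a) b) s t := by
  have hω := h.path.smoothAt_omega hs ht
  have hρs := h.smoothAt_normalSpeed hs ht
  have h1 := ((hω.pathDeriv hs ht).neg).mul
    ((hρs.mul hω).inv (mul_ne_zero (hρ s hs t ht) (h.path.omega_pos hs ht).ne'))
  refine h1.congr_of_eventuallyEq ⟨hs, ht⟩ ?_
  filter_upwards [self_mem_nhdsWithin] with q hq
  have h2 := hρ q.1 hq.1 q.2 hq.2
  have h3 := (h.path.omega_pos hq.1 hq.2).ne'
  rw [h.pathDeriv_omega hq.1 hq.2]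
  field_simp

theorem smoothAt_arcDeriv (h : IsCurvePath D c) {f : ℝ → ℝ → ℝ} (hf : SmoothAt D f s t)
    (hs : s ∈ Icc (0 : ℝ) 1) (ht : t ∈ D.carrier) :
    SmoothAt D (fun a b => arcDeriv D (c a) (f a) b) s t :=
  ((h.smoothAt_omega hs ht).inv (h.omega_pos hs ht).ne').mul (hf.curveDeriv hs ht)

/-- The evolution of the signed curvature along the path. -/
theorem pathDeriv_curvature (h : IsFramedNormalPath D c N) (hs : s ∈ Icc (0 : ℝ) 1)
    (ht : t ∈ D.carrier)
    (hρ : ∀ s ∈ Icc (0 : ℝ) 1, ∀ t ∈ D.carrier, normalSpeed c N s t ≠ 0) :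
    pathDeriv (fun a b => curvature D (c a) (N a) b) s t =
      arcDeriv D (c s) (fun b => arcDeriv D (c s) (normalSpeed c N s) b) t +
      normalSpeed c N s t * (curvature D (c s) (N s) t ^ 2 +
        sectionalCurvature (c s t) (N s t) (unitTangent D (c s) t)) := by
  have hq : c s t ∈ (chartAt (EuclideanSpace ℝ (Fin 2)) (c s t)).source := mem_chart_source _ _
  have hω := h.path.smoothAt_omega hs ht
  have hω0 := (h.path.omega_pos hs ht).ne'
  have hκ := h.smoothAt_curvature hs ht hρ
  have hρθ := smoothAt_arcDeriv h.path (h.smoothAt_normalSpeed hs ht) hs ht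
  have hN := h.smoothFieldAt_normal hs ht hq
  have hev := h.path.eventually_mem_source hs ht hq
  have hR := h.path.covDerivInChart_comm hs ht (h.path.smoothFieldAt_unitTangent hs ht hq)
  -- This is `∇_s` of `∇_t T = ωκN`; the next identity is `∇_t` of `∇_s T = ρ_θ N`.
  have e1 : covDerivInChart (c s t) (Icc 0 1) (fun r => c r t) (fun r =>
        covDerivInChart (c s t) D.carrier (c r) (unitTangent D (c r)) t) s =
      pathDeriv (fun a b => omega D (c a) b * curvature D (c a) (N a) b) s t • N s t +
        (omega D (c s) t * curvature D (c s) (N s) t) •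
          covDerivInChart (c s t) (Icc 0 1) (fun r => c r t) (fun r => N r t) s := by
    rw [covDerivInChart_congr (γ := fun r => c r t)
      (W := fun r => (omega D (c r) t * curvature D (c r) (N r) t) • N r t) hs]
    · exact covDerivInChart_smul (γ := fun r => c r t) hq
        ((hω.mul hκ).hasDerivWithinAt_left ht).differentiableWithinAt (hN.differentiable_left ht)
    · filter_upwards [self_mem_nhdsWithin, eventually_strip_left
        (P := fun a b => c a b ∈ (chartAt (EuclideanSpace ℝ (Fin 2)) (c s t)).source) ht hev]
        with r hr hr'
      exact (h.covDerivInChart_right hr ht hr' (hρ r hr t ht)).1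
  have e2 : covDerivInChart (c s t) D.carrier (c s) (fun b =>
        covDerivInChart (c s t) (Icc 0 1) (fun r => c r b) (fun r => unitTangent D (c r) b) s) t =
      curveDeriv D (fun a b => arcDeriv D (c a) (normalSpeed c N a) b) s t • N s t +
        arcDeriv D (c s) (normalSpeed c N s) t •
          covDerivInChart (c s t) D.carrier (c s) (N s) t := by
    rw [covDerivInChart_congr (W := fun b => arcDeriv D (c s) (normalSpeed c N s) b • N s b) ht]
    · exact covDerivInChart_smul hq (hρθ.hasDerivWithinAt_right hs).differentiableWithinAt
        (hN.differentiable_right hs)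
    · filter_upwards [self_mem_nhdsWithin, eventually_strip_right
        (P := fun a b => c a b ∈ (chartAt (EuclideanSpace ℝ (Fin 2)) (c s t)).source) hs hev]
        with r hr hr'
      exact (h.covDerivInChart_left hs hr hr').1
  rw [e1, e2, (h.covDerivInChart_left hs ht hq).2,
    (h.covDerivInChart_right hs ht hq (hρ s hs t ht)).2, h.pathVelocity_eq hs ht,
    h.path.velocity_eq hs ht, curvatureTensor_smul_smul] at hR
  have hTT := h.path.inner_unitTangent hs ht
  have hNN := h.field.unit s hs t ht
  have hTN := h.inner_normal hs ht
  have hNT : inner ℝ (N s t) (unitTangent D (c s) t) = (0 : ℝ) := by rw [real_inner_comm, hTN]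
  -- The normal component reads `(ωκ)' = ∂_t ρ_θ + ρωK`; inserting `ω' = -ρκω` yields the term
  -- `ρκ²`.
  have i1 := congrArg (fun v => (inner ℝ v (N s t) : ℝ)) hR
  simp only [inner_add_left, real_inner_smul_left, hNN, hTN] at i1
  have hK : sectionalCurvature (c s t) (N s t) (unitTangent D (c s) t) =
      inner ℝ (curvatureTensor (c s t) (N s t) (unitTangent D (c s) t)
        (unitTangent D (c s) t)) (N s t) := by
    rw [sectionalCurvature, hNN, hTT, hNT]
    simp
  have e3 : pathDeriv (fun a b => omega D (c a) b * curvature D (c a) (N a) b) s t =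
      pathDeriv (fun a b => omega D (c a) b) s t * curvature D (c s) (N s) t +
        omega D (c s) t * pathDeriv (fun a b => curvature D (c a) (N a) b) s t :=
    ((hω.hasDerivWithinAt_left ht).fun_mul (hκ.hasDerivWithinAt_left ht)).derivWithin
      (uniqueDiffOn_Icc zero_lt_one s hs)
  rw [e3, h.pathDeriv_omega hs ht, ← hK] at i1
  have e4 : arcDeriv D (c s) (fun b => arcDeriv D (c s) (normalSpeed c N s) b) t =
      (omega D (c s) t)⁻¹ *
        curveDeriv D (fun a b => arcDeriv D (c a) (normalSpeed c N a) b) s t := rfl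
  rw [e4]
  field_simp
  linear_combination i1

end IsFramedNormalPath

end Curvature

/-! ### Horizontal paths -/

namespace ParamDomain

theorem length_pos (D : ParamDomain) : 0 < D.length := by
  cases D
  · exact Real.two_pi_pos
  · exact zero_lt_one

theorem Icc_subset_carrier (D : ParamDomain) : Icc 0 D.length ⊆ D.carrier := by
  cases D
  · exact subset_univ _
  · exact subset_rfl

theorem carrier_mem_nhds (D : ParamDomain) {t : ℝ} (ht : t ∈ Ioo 0 D.length) :
    D.carrier ∈ nhds t :=
  Filter.mem_of_superset (Icc_mem_nhds ht.1 ht.2) D.Icc_subset_carrier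

/-- A nonnegative smooth function vanishing exactly at the ends of the parameter domain. -/
def weight : ParamDomain → ℝ → ℝ
  | circle, _ => 1
  | interval, t => t * (1 - t)

theorem contDiff_weight (D : ParamDomain) : ContDiff ℝ ∞ D.weight := by
  cases D
  · exact contDiff_const
  · exact contDiff_id.mul (contDiff_const.sub contDiff_id)

theorem weight_pos (D : ParamDomain) {t : ℝ} (ht : t ∈ Ioo 0 D.length) : 0 < D.weight t := by
  cases D
  · exact zero_lt_one
  · exact mul_pos ht.1 (sub_pos.2 ht.2)

theorem weight_nonneg (D : ParamDomain) {t : ℝ} (ht : t ∈ Icc 0 D.length) : 0 ≤ D.weight t := by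
  cases D
  · exact zero_le_one
  · exact mul_nonneg ht.1 (sub_nonneg.2 ht.2)

/-- The weight enforces the boundary condition on the interval while staying positive inside, so no
sign information is lost. -/
theorem isTestFunction_weight_mul (D : ParamDomain) {f : ℝ → ℝ}
    (hf : ContDiffOn ℝ ∞ f D.carrier) (hD : D.Descends f) :
    D.IsTestFunction fun t => D.weight t * f t := by
  refine ⟨D.contDiff_weight.contDiffOn.mul hf, ?_, ?_⟩
  · cases D
    · intro t
      simpa [weight] using hD t
    · trivial
  · cases D
    · trivial
    · simp [VanishesAtEnds, weight]

/-- A continuous function on the parameter domain is determined by its values inside. -/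
theorem eq_zero_of_Ioo (D : ParamDomain) {f : ℝ → ℝ} (hf : ContinuousOn f D.carrier)
    (hD : D.Descends f) (h0 : ∀ t ∈ Ioo 0 D.length, f t = 0) {t : ℝ} (ht : t ∈ D.carrier) :
    f t = 0 := by
  have h1 : ∀ t ∈ Icc 0 D.length, f t = 0 := by
    have h2 : EqOn f (fun _ => 0) (Icc 0 D.length) :=
      EqOn.of_subset_closure (s := Ioo 0 D.length) h0 (hf.mono D.Icc_subset_carrier)
        continuousOn_const Ioo_subset_Icc_self (closure_Ioo D.length_pos.ne).ge
    exact h2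
  cases D
  · obtain ⟨y, hy, hxy⟩ := Function.Periodic.exists_mem_Ico₀ hD Real.two_pi_pos t
    rw [hxy]
    exact h1 y (Ico_subset_Icc_self hy)
  · exact h1 t ht

/-- Integration by parts without boundary terms. -/
theorem integral_derivWithin_eq_zero (D : ParamDomain) {f : ℝ → ℝ}
    (hf : ContDiffOn ℝ ∞ f D.carrier) (h : f D.length = f 0) :
    ∫ t in (0 : ℝ)..D.length, derivWithin f D.carrier t = 0 := by
  have hc : ContinuousOn (derivWithin f D.carrier) (Icc 0 D.length) :=
    (hf.continuousOn_derivWithin D.uniqueDiffOn_carrier (by simp)).mono D.Icc_subset_carrier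
  rw [intervalIntegral.integral_eq_sub_of_hasDerivAt_of_le (f := f) D.length_pos.le
    (hf.continuousOn.mono D.Icc_subset_carrier) ?_ ?_, h, sub_self]
  · intro t ht
    exact ((hf.differentiableOn (by simp)) t
      (D.Icc_subset_carrier (Ioo_subset_Icc_self ht))).hasDerivWithinAt.hasDerivAt
      (D.carrier_mem_nhds ht)
  · exact hc.intervalIntegrable_of_Icc D.length_pos.le

theorem Descends.derivWithin {D : ParamDomain} {f : ℝ → ℝ} (h : D.Descends f) :
    D.Descends (derivWithin f D.carrier) := by
  cases D
  · intro t
    simp only [carrier, derivWithin_univ]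
    rw [← deriv_comp_add_const]
    congr 1
    funext x
    exact h x
  · trivial

/-- Fundamental lemma of the calculus of variations: integrating the second term by parts turns the
hypothesis into `∫ E a w = 0` with `E = 2r'k + rk'`, and `a` may be taken proportional to `E`. It is
applied with `r = ρ`, `k = κ`, `w = ω`. -/
theorem eq_zero_of_forall_isTestFunction (D : ParamDomain) {r k w : ℝ → ℝ}
    (hr : ContDiffOn ℝ ∞ r D.carrier) (hk : ContDiffOn ℝ ∞ k D.carrier)
    (hw : ContDiffOn ℝ ∞ w D.carrier) (dr : D.Descends r) (dk : D.Descends k)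
    (dw : D.Descends w) (hpos : ∀ t ∈ D.carrier, 0 < w t)
    (H : ∀ a, D.IsTestFunction a → ∫ t in (0 : ℝ)..D.length,
      (_root_.derivWithin r D.carrier t * k t * (a t * w t) -
        r t * k t * _root_.derivWithin (fun x => a x * w x) D.carrier t) = 0)
    {t : ℝ} (ht : t ∈ D.carrier) :
    2 * _root_.derivWithin r D.carrier t * k t + r t * _root_.derivWithin k D.carrier t = 0 := by
  have hr' := hr.derivWithin D.uniqueDiffOn_carrier (m := ∞) (by simp)
  have hk' := hk.derivWithin D.uniqueDiffOn_carrier (m := ∞) (by simp)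
  set E : ℝ → ℝ := fun t =>
    2 * _root_.derivWithin r D.carrier t * k t + r t * _root_.derivWithin k D.carrier t with hE
  have cE : ContDiffOn ℝ ∞ E D.carrier := ((contDiffOn_const.mul hr').mul hk).add (hr.mul hk')
  have dE : D.Descends E := by
    have d1 := dr.derivWithin
    have d2 := dk.derivWithin
    cases D
    · intro x
      simp only [hE]
      rw [d1 x, d2 x, dr x, dk x]
    · trivial
  -- With `a = weight · E` the integrand becomes `weight · w · E²`, which is nonnegative.
  have htest := D.isTestFunction_weight_mul cE dE
  set a : ℝ → ℝ := fun t => D.weight t * E t with ha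
  have cb := htest.1.mul hw
  have cf : ContDiffOn ℝ ∞ (fun x => r x * k x * (a x * w x)) D.carrier := (hr.mul hk).mul cb
  -- The boundary terms cancel by periodicity on the circle and vanish with `a` on the interval.
  have hbd : r D.length * k D.length * (a D.length * w D.length) = r 0 * k 0 * (a 0 * w 0) := by
    have hv := htest.2
    cases D
    · have e : ∀ {f : ℝ → ℝ}, ParamDomain.circle.Descends f → f (2 * Real.pi) = f 0 := by
        intro f hf
        simpa using hf 0
      simp only [length]
      rw [e dr, e dk, e hv.1, e dw]
    · have h2 := hv.2
      simp only [VanishesAtEnds] at h2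
      simp only [length, h2.1, h2.2]
      ring
  have h1 := D.integral_derivWithin_eq_zero cf hbd
  have hsub : Icc 0 D.length ⊆ D.carrier := D.Icc_subset_carrier
  have i1 : IntervalIntegrable (_root_.derivWithin (fun x => r x * k x * (a x * w x)) D.carrier)
      MeasureTheory.volume 0 D.length :=
    ((cf.continuousOn_derivWithin D.uniqueDiffOn_carrier (by simp)).mono
      hsub).intervalIntegrable_of_Icc D.length_pos.le
  have c2 : ContinuousOn (fun t => E t * (a t * w t)) (Icc 0 D.length) :=
    (cE.continuousOn.mul cb.continuousOn).mono hsub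
  have h2 : ∫ t in (0 : ℝ)..D.length, E t * (a t * w t) = 0 := by
    have h3 := intervalIntegral.integral_sub (c2.intervalIntegrable_of_Icc D.length_pos.le) i1
    rw [h1, sub_zero] at h3
    rw [← h3]
    refine Eq.trans ?_ (H a htest)
    refine intervalIntegral.integral_congr fun t ht => ?_
    rw [uIcc_of_le D.length_pos.le] at ht
    have ht := hsub ht
    have hb : DifferentiableWithinAt ℝ (fun x => a x * w x) D.carrier t :=
      (ContDiffOn.differentiableOn (f := fun x => a x * w x) cb (by simp)) t ht
    have hd := ((((hr.differentiableOn (by simp)) t ht).hasDerivWithinAt.fun_mul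
      ((hk.differentiableOn (by simp)) t ht).hasDerivWithinAt).fun_mul
        hb.hasDerivWithinAt).derivWithin (D.uniqueDiffOn_carrier t ht)
    simp only [hE]
    rw [hd]
    ring
  have hz : ∀ t ∈ Ioo 0 D.length, E t = 0 := by
    intro t ht
    by_contra hne
    have hlt : 0 < ∫ t in (0 : ℝ)..D.length, E t * (a t * w t) := by
      refine intervalIntegral.integral_pos D.length_pos c2 (fun x hx => ?_)
        ⟨t, Ioo_subset_Icc_self ht, ?_⟩
      · have hx' := Ioc_subset_Icc_self hx
        have e : E x * (a x * w x) = D.weight x * w x * E x ^ 2 := by simp only [ha]; ring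
        rw [e]
        exact mul_nonneg (mul_nonneg (D.weight_nonneg hx') (hpos x (hsub hx')).le) (sq_nonneg _)
      · have e : E t * (a t * w t) = D.weight t * w t * E t ^ 2 := by simp only [ha]; ring
        rw [e]
        exact mul_pos (mul_pos (D.weight_pos ht) (hpos t (hsub (Ioo_subset_Icc_self ht))))
          (by positivity)
    exact hlt.ne' h2
  exact D.eq_zero_of_Ioo cE.continuousOn dE hz ht

end ParamDomain

theorem SmoothAt.contDiffOn_right {D : ParamDomain} {f : ℝ → ℝ → ℝ} {s : ℝ}
    (h : ∀ t ∈ D.carrier, SmoothAt D f s t) (hs : s ∈ Icc (0 : ℝ) 1) :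
    ContDiffOn ℝ ∞ (f s) D.carrier := fun t ht =>
  ContDiffWithinAt.comp (g := fun q : ℝ × ℝ => f q.1 q.2) t (h t ht)
    (contDiff_const.prodMk contDiff_id).contDiffWithinAt fun _ hr => ⟨hs, hr⟩

/-! ### Periodicity of the frame data and the horizontality equation -/

section Horizontal

variable {M : Type*} [TopologicalSpace M] [ChartedSpace (EuclideanSpace ℝ (Fin 2)) M]
  [IsManifold (𝓡 2) ∞ M] [RiemannianBundle (fun x : M => TangentSpace (𝓡 2) x)]
  [IsContMDiffRiemannianBundle (𝓡 2) ∞ (EuclideanSpace ℝ (Fin 2))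
    (fun x : M => TangentSpace (𝓡 2) x)]

variable {D : ParamDomain} {c : ℝ → ℝ → M} {N : (s t : ℝ) → TangentSpace (𝓡 2) (c s t)}
  {p : M} {s t : ℝ}

/-- On the circle, the vectors at `t` and `t + 2π` lie in formally different tangent spaces; they
are compared through their components in one chart. -/
theorem inner_eq_of_coord_eq {q q' : M} (hqq : q = q') {v w : TangentSpace (𝓡 2) q}
    {v' w' : TangentSpace (𝓡 2) q'} (hv : coord q v = coord q v') (hw : coord q w = coord q w') :
    (inner ℝ v w : ℝ) = inner ℝ v' w' := by
  subst hqq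
  have hq := mem_chart_source (EuclideanSpace ℝ (Fin 2)) q
  rw [inner_eq_sum hq, inner_eq_sum hq, hv, hw]

theorem IsCurvePath.coord_velocity_periodic {c : ℝ → ℝ → M} (hc : IsCurvePath .circle c)
    (hs : s ∈ Icc (0 : ℝ) 1) (t : ℝ) :
    coord (c s (t + 2 * Real.pi)) (velocity .circle (c s) (t + 2 * Real.pi)) =
      coord (c s (t + 2 * Real.pi)) (velocity .circle (c s) t) := by
  have hq := mem_chart_source (EuclideanSpace ℝ (Fin 2)) (c s (t + 2 * Real.pi))
  have hper := hc.descends s hs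
  have hq' : c s t ∈
      (chartAt (EuclideanSpace ℝ (Fin 2)) (c s (t + 2 * Real.pi))).source := by
    rw [hper t]
    exact mem_chart_source _ _
  ext k
  rw [hc.coord_velocity hs (mem_univ _) hq, hc.coord_velocity hs (mem_univ _) hq']
  refine ParamDomain.Descends.derivWithin (D := .circle) (f := pathCoord _ c k s) ?_ t
  intro x
  exact congrArg (fun z => extChartAt (𝓡 2) _ z k) (hper x)

theorem IsCurvePath.coord_pathVelocity_periodic {c : ℝ → ℝ → M} (hc : IsCurvePath .circle c)
    (hs : s ∈ Icc (0 : ℝ) 1) (t : ℝ) :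
    coord (c s (t + 2 * Real.pi)) (pathVelocity c s (t + 2 * Real.pi)) =
      coord (c s (t + 2 * Real.pi)) (pathVelocity c s t) := by
  have hq := mem_chart_source (EuclideanSpace ℝ (Fin 2)) (c s (t + 2 * Real.pi))
  have hq' : c s t ∈
      (chartAt (EuclideanSpace ℝ (Fin 2)) (c s (t + 2 * Real.pi))).source := by
    rw [hc.descends s hs t]
    exact mem_chart_source _ _
  ext k
  rw [hc.coord_pathVelocity hs (mem_univ _) hq, hc.coord_pathVelocity hs (mem_univ _) hq']
  have h1 : ∀ r ∈ Icc (0 : ℝ) 1, pathCoord (c s (t + 2 * Real.pi)) c k r (t + 2 * Real.pi) =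
      pathCoord (c s (t + 2 * Real.pi)) c k r t := fun r hr =>
    congrArg (fun z => extChartAt (𝓡 2) _ z k) (hc.descends r hr t)
  exact derivWithin_congr h1 (h1 s hs)

theorem IsCurvePath.descends_omega (hc : IsCurvePath D c) (hs : s ∈ Icc (0 : ℝ) 1) :
    D.Descends (omega D (c s)) := by
  cases D
  · intro t
    have h1 := inner_eq_of_coord_eq (hc.descends s hs t) (hc.coord_velocity_periodic hs t)
      (hc.coord_velocity_periodic hs t)
    rw [omega, omega, norm_eq_sqrt_real_inner, norm_eq_sqrt_real_inner, h1]
  · trivial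

namespace IsFramedNormalPath

theorem descends_normalSpeed (h : IsFramedNormalPath D c N) (hs : s ∈ Icc (0 : ℝ) 1) :
    D.Descends (normalSpeed c N s) := by
  cases D
  · intro t
    refine inner_eq_of_coord_eq (h.path.descends s hs t) (h.path.coord_pathVelocity_periodic hs t)
      ?_
    exact congrArg (fun v : TangentBundle (𝓡 2) M => coord (c s (t + 2 * Real.pi)) v.2)
      (h.field.descends s hs t)
  · trivial

/-- Periodicity is inherited from `ω`, `ω'` and `ρ` through `ω' = -ρκω`, which avoids transporting
covariant derivatives between fibres. -/
theorem descends_curvature (h : IsFramedNormalPath D c N)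
    (hρ : ∀ s ∈ Icc (0 : ℝ) 1, ∀ t ∈ D.carrier, normalSpeed c N s t ≠ 0)
    (hs : s ∈ Icc (0 : ℝ) 1) : D.Descends (curvature D (c s) (N s)) := by
  cases D
  · intro t
    have ht : ∀ r, r ∈ ParamDomain.circle.carrier := mem_univ
    have h1 := h.pathDeriv_omega hs (ht (t + 2 * Real.pi))
    have h2 := h.pathDeriv_omega hs (ht t)
    have h3 : pathDeriv (fun a b => omega .circle (c a) b) s (t + 2 * Real.pi) =
        pathDeriv (fun a b => omega .circle (c a) b) s t :=
      derivWithin_congr (fun r hr => h.path.descends_omega hr t) (h.path.descends_omega hs t)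
    have h4 : omega .circle (c s) (t + 2 * Real.pi) = omega .circle (c s) t :=
      h.path.descends_omega hs t
    have h5 : normalSpeed c N s (t + 2 * Real.pi) = normalSpeed c N s t :=
      h.descends_normalSpeed hs t
    rw [h3, h2, h4, h5, neg_inj] at h1
    exact (mul_left_cancel₀ (hρ s hs t (ht t))
      (mul_right_cancel₀ (h.path.omega_pos hs (ht t)).ne' h1)).symm
  · trivial

theorem nablaT_pathVelocity (h : IsFramedNormalPath D c N) (hs : s ∈ Icc (0 : ℝ) 1)
    (ht : t ∈ D.carrier) (hρ : normalSpeed c N s t ≠ 0) :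
    nablaT D (c s) (pathVelocity c s) t =
      arcDeriv D (c s) (normalSpeed c N s) t • N s t -
        (normalSpeed c N s t * curvature D (c s) (N s) t) • unitTangent D (c s) t := by
  have hq : c s t ∈ (chartAt (EuclideanSpace ℝ (Fin 2)) (c s t)).source := mem_chart_source _ _
  have h0 := (h.path.omega_pos hs ht).ne'
  rw [nablaT, covDeriv, covDerivInChart_congr (W := fun r => normalSpeed c N s r • N s r) ht
    (eventually_nhdsWithin_of_forall fun r hr => h.pathVelocity_eq hs hr),
    covDerivInChart_smul hq
      ((h.smoothAt_normalSpeed hs ht).hasDerivWithinAt_right hs).differentiableWithinAt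
      ((h.smoothFieldAt_normal hs ht hq).differentiable_right hs),
    (h.covDerivInChart_right hs ht hq hρ).2, smul_add, smul_smul, smul_smul, smul_smul,
    sub_eq_add_neg, ← neg_smul]
  congr 2
  field_simp

theorem nablaT_smul_velocity (h : IsFramedNormalPath D c N) (hs : s ∈ Icc (0 : ℝ) 1)
    (ht : t ∈ D.carrier) (hρ : normalSpeed c N s t ≠ 0) {a : ℝ → ℝ}
    (ha : DifferentiableWithinAt ℝ a D.carrier t) :
    nablaT D (c s) (fun r => a r • velocity D (c s) r) t =
      arcDeriv D (c s) (fun r => a r * omega D (c s) r) t • unitTangent D (c s) t +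
        (a t * omega D (c s) t * curvature D (c s) (N s) t) • N s t := by
  have hq : c s t ∈ (chartAt (EuclideanSpace ℝ (Fin 2)) (c s t)).source := mem_chart_source _ _
  have h0 := (h.path.omega_pos hs ht).ne'
  rw [nablaT, covDeriv, covDerivInChart_congr
      (W := fun r => (a r * omega D (c s) r) • unitTangent D (c s) r) ht
    (eventually_nhdsWithin_of_forall fun r hr => by
      rw [mul_smul, ← h.path.velocity_eq hs hr]),
    covDerivInChart_smul hq
      (ha.fun_mul
        ((h.path.smoothAt_omega hs ht).hasDerivWithinAt_right hs).differentiableWithinAt)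
      ((h.path.smoothFieldAt_unitTangent hs ht hq).differentiable_right hs),
    (h.covDerivInChart_right hs ht hq hρ).1, smul_add, smul_smul, smul_smul, smul_smul]
  congr 2
  field_simp

theorem contDiffOn_normalSpeed (h : IsFramedNormalPath D c N) (hs : s ∈ Icc (0 : ℝ) 1) :
    ContDiffOn ℝ ∞ (normalSpeed c N s) D.carrier :=
  SmoothAt.contDiffOn_right (fun _ ht => h.smoothAt_normalSpeed hs ht) hs

theorem contDiffOn_omega (h : IsFramedNormalPath D c N) (hs : s ∈ Icc (0 : ℝ) 1) :
    ContDiffOn ℝ ∞ (omega D (c s)) D.carrier :=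
  SmoothAt.contDiffOn_right (fun _ ht => h.path.smoothAt_omega hs ht) hs

theorem contDiffOn_curvature (h : IsFramedNormalPath D c N)
    (hρ : ∀ s ∈ Icc (0 : ℝ) 1, ∀ t ∈ D.carrier, normalSpeed c N s t ≠ 0)
    (hs : s ∈ Icc (0 : ℝ) 1) : ContDiffOn ℝ ∞ (curvature D (c s) (N s)) D.carrier :=
  SmoothAt.contDiffOn_right (fun _ ht => h.smoothAt_curvature hs ht hρ) hs

/-- The metric on the tangent field of the path and a vertical field. -/
theorem sobolevMetric_vertical (h : IsFramedNormalPath D c N) (hs : s ∈ Icc (0 : ℝ) 1)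
    (hρ : ∀ s ∈ Icc (0 : ℝ) 1, ∀ t ∈ D.carrier, normalSpeed c N s t ≠ 0) {a : ℝ → ℝ}
    (ha : DifferentiableOn ℝ a D.carrier) :
    sobolevMetric D (c s) (pathVelocity c s) (fun t => a t • velocity D (c s) t) =
      ∫ t in (0 : ℝ)..D.length, (derivWithin (normalSpeed c N s) D.carrier t *
        curvature D (c s) (N s) t * (a t * omega D (c s) t) -
        normalSpeed c N s t * curvature D (c s) (N s) t *
          derivWithin (fun r => a r * omega D (c s) r) D.carrier t) := by
  refine intervalIntegral.integral_congr fun t ht => ?_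
  rw [uIcc_of_le D.length_pos.le] at ht
  have ht := D.Icc_subset_carrier ht
  have h0 := (h.path.omega_pos hs ht).ne'
  have hTT := h.path.inner_unitTangent hs ht
  have hNN := h.field.unit s hs t ht
  have hTN := h.inner_normal hs ht
  have hNT : inner ℝ (N s t) (unitTangent D (c s) t) = (0 : ℝ) := by rw [real_inner_comm, hTN]
  simp only
  -- The zeroth-order term vanishes because `c'` is normal and the test field tangential; only the
  -- derivative terms survive.
  rw [h.nablaT_pathVelocity hs ht (hρ s hs t ht),
    h.nablaT_smul_velocity hs ht (hρ s hs t ht) (ha t ht), h.pathVelocity_eq hs ht,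
    real_inner_smul_left, real_inner_smul_right, h.field.normal s hs t ht, arcDeriv, arcDeriv]
  simp only [inner_add_right, inner_sub_left, real_inner_smul_left, real_inner_smul_right, hTT,
    hNN, hTN, hNT]
  field_simp
  ring

/-- The squared length of the tangent field of the path. -/
theorem sobolevMetric_pathVelocity (h : IsFramedNormalPath D c N) (hs : s ∈ Icc (0 : ℝ) 1)
    (hρ : ∀ s ∈ Icc (0 : ℝ) 1, ∀ t ∈ D.carrier, normalSpeed c N s t ≠ 0) :
    sobolevMetric D (c s) (pathVelocity c s) (pathVelocity c s) =
      ∫ t in (0 : ℝ)..D.length, (normalSpeed c N s t ^ 2 * (1 + curvature D (c s) (N s) t ^ 2) +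
        arcDeriv D (c s) (normalSpeed c N s) t ^ 2) * omega D (c s) t := by
  refine intervalIntegral.integral_congr fun t ht => ?_
  rw [uIcc_of_le D.length_pos.le] at ht
  have ht := D.Icc_subset_carrier ht
  have hTT := h.path.inner_unitTangent hs ht
  have hNN := h.field.unit s hs t ht
  have hTN := h.inner_normal hs ht
  have hNT : inner ℝ (N s t) (unitTangent D (c s) t) = (0 : ℝ) := by rw [real_inner_comm, hTN]
  rw [h.nablaT_pathVelocity hs ht (hρ s hs t ht), h.pathVelocity_eq hs ht]
  simp only [inner_sub_right, inner_sub_left, real_inner_smul_left, real_inner_smul_right, hTT,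
    hNN, hTN, hNT]
  ring

/-- Horizontality of a normal path as a differential equation. -/
theorem horizontal_equation (h : IsFramedNormalPath D c N) (hhor : IsHorizontalPath D c)
    (hρ : ∀ s ∈ Icc (0 : ℝ) 1, ∀ t ∈ D.carrier, normalSpeed c N s t ≠ 0)
    (hs : s ∈ Icc (0 : ℝ) 1) (ht : t ∈ D.carrier) :
    2 * derivWithin (normalSpeed c N s) D.carrier t * curvature D (c s) (N s) t +
      normalSpeed c N s t * derivWithin (curvature D (c s) (N s)) D.carrier t = 0 := by
  refine D.eq_zero_of_forall_isTestFunction (h.contDiffOn_normalSpeed hs)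
    (h.contDiffOn_curvature hρ hs) (h.contDiffOn_omega hs) (h.descends_normalSpeed hs)
    (h.descends_curvature hρ hs) (h.path.descends_omega hs)
    (fun t ht => h.path.omega_pos hs ht) (fun a ha => ?_) ht
  rw [← h.sobolevMetric_vertical hs hρ (ha.1.differentiableOn (by simp))]
  exact hhor s hs a ha

end IsFramedNormalPath

end Horizontal

/-! ### Parallel tangent fields, geodesics, and stationary curvature -/

theorem ParamDomain.zero_mem_carrier (D : ParamDomain) : (0 : ℝ) ∈ D.carrier :=
  D.Icc_subset_carrier ⟨le_rfl, D.length_pos.le⟩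

/-- A function with vanishing derivative on a convex set of reals is constant. -/
theorem eq_of_hasDerivWithinAt_zero {S : Set ℝ} (hS : Convex ℝ S) {f : ℝ → ℝ}
    (hf : ∀ x ∈ S, HasDerivWithinAt f 0 S x) {x y : ℝ} (hx : x ∈ S) (hy : y ∈ S) : f x = f y := by
  have h := hS.norm_image_sub_le_of_norm_hasDerivWithin_le (C := 0) hf (by simp) hy hx
  simpa [sub_eq_zero] using h

theorem eq_zero_of_subset_closure {A S : Set ℝ} {f : ℝ → ℝ} (hf : ContinuousOn f S)
    (hA : A ⊆ S) (hS : S ⊆ closure A) (h : ∀ x ∈ A, f x = 0) {x : ℝ} (hx : x ∈ S) : f x = 0 :=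
  EqOn.of_subset_closure (g := fun _ => 0) h hf continuousOn_const hA hS hx

section Results

variable {M : Type*} [TopologicalSpace M] [ChartedSpace (EuclideanSpace ℝ (Fin 2)) M]
  [IsManifold (𝓡 2) ∞ M] [RiemannianBundle (fun x : M => TangentSpace (𝓡 2) x)]
  [IsContMDiffRiemannianBundle (𝓡 2) ∞ (EuclideanSpace ℝ (Fin 2))
    (fun x : M => TangentSpace (𝓡 2) x)]

variable {D : ParamDomain} {c : ℝ → ℝ → M} {N : (s t : ℝ) → TangentSpace (𝓡 2) (c s t)}
  {s t : ℝ}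

theorem arcDeriv_eq_zero_iff (hc : IsCurvePath D c) (hs : s ∈ Icc (0 : ℝ) 1)
    (ht : t ∈ D.carrier) {f : ℝ → ℝ} :
    arcDeriv D (c s) f t = 0 ↔ derivWithin f D.carrier t = 0 := by
  simp [arcDeriv, (hc.omega_pos hs ht).ne']

theorem SmoothAt.continuousOn_left {f : ℝ → ℝ → ℝ}
    (h : ∀ s ∈ Icc (0 : ℝ) 1, SmoothAt D f s t) (ht : t ∈ D.carrier) :
    ContinuousOn (fun s => f s t) (Icc 0 1) := fun s hs =>
  ((h s hs).hasDerivWithinAt_left ht).continuousWithinAt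

namespace IsFramedNormalPath

/-- The tangent field is parallel along the path iff `ρ` is constant along the curves. -/
theorem tangentIsParallel_iff (h : IsFramedNormalPath D c N) : TangentIsParallel D c ↔
    ∀ s ∈ Icc (0 : ℝ) 1, ∀ t ∈ D.carrier, derivWithin (normalSpeed c N s) D.carrier t = 0 := by
  refine forall₂_congr fun s hs => forall₂_congr fun t ht => ?_
  have h1 := (h.covDerivInChart_left (p := c s t) hs ht (mem_chart_source _ _)).1
  rw [← arcDeriv_eq_zero_iff h.path hs ht]
  change covDerivInChart (c s t) (Icc 0 1) (fun r => c r t) (fun r => unitTangent D (c r) t) s = 0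
    ↔ _
  have hN : N s t ≠ 0 := fun h0 => by
    have h2 := h.field.unit s hs t ht
    rw [h0, inner_zero_left] at h2
    exact zero_ne_one h2
  rw [h1, smul_eq_zero]
  exact or_iff_left hN

/-- With `ρ_θ = 0` the horizontality equation reduces to `ρκ_θ = 0`. -/
theorem derivWithin_curvature_eq_zero (h : IsFramedNormalPath D c N)
    (hhor : IsHorizontalPath D c)
    (hρ : ∀ s ∈ Icc (0 : ℝ) 1, ∀ t ∈ D.carrier, normalSpeed c N s t ≠ 0)
    (hpar : TangentIsParallel D c) (hs : s ∈ Icc (0 : ℝ) 1) (ht : t ∈ D.carrier) :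
    derivWithin (curvature D (c s) (N s)) D.carrier t = 0 := by
  have h1 := h.horizontal_equation hhor hρ hs ht
  rw [h.tangentIsParallel_iff.1 hpar s hs t ht] at h1
  simpa [hρ s hs t ht] using h1

theorem curvature_eq_of_derivWithin_eq_zero (h : IsFramedNormalPath D c N)
    (hρ : ∀ s ∈ Icc (0 : ℝ) 1, ∀ t ∈ D.carrier, normalSpeed c N s t ≠ 0)
    (hκ : ∀ s ∈ Icc (0 : ℝ) 1, ∀ t ∈ D.carrier,
      derivWithin (curvature D (c s) (N s)) D.carrier t = 0)
    (hs : s ∈ Icc (0 : ℝ) 1) {t t' : ℝ} (ht : t ∈ D.carrier) (ht' : t' ∈ D.carrier) :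
    curvature D (c s) (N s) t = curvature D (c s) (N s) t' := by
  refine eq_of_hasDerivWithinAt_zero D.convex_carrier (fun x hx => ?_) ht ht'
  have h1 := ((h.contDiffOn_curvature hρ hs).differentiableOn (by simp) x hx).hasDerivWithinAt
  rwa [hκ s hs x hx] at h1

theorem normalSpeed_eq_of_tangentIsParallel (h : IsFramedNormalPath D c N)
    (hpar : TangentIsParallel D c) (hs : s ∈ Icc (0 : ℝ) 1) {t t' : ℝ} (ht : t ∈ D.carrier)
    (ht' : t' ∈ D.carrier) : normalSpeed c N s t = normalSpeed c N s t' := by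
  refine eq_of_hasDerivWithinAt_zero D.convex_carrier (fun x hx => ?_) ht ht'
  have h1 := ((h.contDiffOn_normalSpeed hs).differentiableOn (by simp) x hx).hasDerivWithinAt
  rwa [h.tangentIsParallel_iff.1 hpar s hs x hx] at h1

/-- Horizontality leaves `ρ_θκ = 0`. As `κ` is constant on each curve, a curve with `κ` not
identically zero has no zero of `κ`, so `ρ_θ = 0` on it; continuity in `s` covers the other curves.
-/
theorem tangentIsParallel_of_dense (h : IsFramedNormalPath D c N) (hhor : IsHorizontalPath D c)
    (hρ : ∀ s ∈ Icc (0 : ℝ) 1, ∀ t ∈ D.carrier, normalSpeed c N s t ≠ 0)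
    (hd : Icc (0 : ℝ) 1 ⊆
      closure {s | s ∈ Icc (0 : ℝ) 1 ∧ ∃ t ∈ D.carrier, curvature D (c s) (N s) t ≠ 0})
    (hκ : ∀ s ∈ Icc (0 : ℝ) 1, ∀ t ∈ D.carrier,
      derivWithin (curvature D (c s) (N s)) D.carrier t = 0) : TangentIsParallel D c := by
  rw [h.tangentIsParallel_iff]
  intro s hs t ht
  refine eq_zero_of_subset_closure (f := fun s => curveDeriv D (normalSpeed c N) s t)
    (SmoothAt.continuousOn_left (fun s hs => (h.smoothAt_normalSpeed hs ht).curveDeriv hs ht) ht)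
    (fun s hs => hs.1) hd ?_ hs
  rintro s ⟨hs, t', ht', hne⟩
  rw [h.curvature_eq_of_derivWithin_eq_zero hρ hκ hs ht' ht] at hne
  have h1 := h.horizontal_equation hhor hρ hs ht
  rw [hκ s hs t ht, mul_zero, add_zero, mul_assoc] at h1
  exact (mul_eq_zero.1 ((mul_eq_zero.1 h1).resolve_left two_ne_zero)).resolve_right hne

/-- The energy density of a path with parallel tangent field. -/
noncomputable def energyDensity (D : ParamDomain) (c : ℝ → ℝ → M)
    (N : (s t : ℝ) → TangentSpace (𝓡 2) (c s t)) (s t : ℝ) : ℝ :=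
  normalSpeed c N s t ^ 2 * (1 + curvature D (c s) (N s) t ^ 2) * omega D (c s) t

theorem energyDensity_pos (h : IsFramedNormalPath D c N)
    (hρ : ∀ s ∈ Icc (0 : ℝ) 1, ∀ t ∈ D.carrier, normalSpeed c N s t ≠ 0)
    (hs : s ∈ Icc (0 : ℝ) 1) (ht : t ∈ D.carrier) : 0 < energyDensity D c N s t := by
  have h1 := hρ s hs t ht
  have h2 := h.path.omega_pos hs ht
  unfold energyDensity
  positivity

/-- By `ω' = -ρκω`, the difference of the two sides of the first equation, times `1 + κ²`, is `ωκ²(e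
- a)`. -/
theorem pathDeriv_omega_sq_iff (h : IsFramedNormalPath D c N) (hs : s ∈ Icc (0 : ℝ) 1)
    (ht : t ∈ D.carrier) (a : ℝ) :
    pathDeriv (fun a b => omega D (c a) b) s t ^ 2 =
      a * omega D (c s) t * curvature D (c s) (N s) t ^ 2 / (1 + curvature D (c s) (N s) t ^ 2) ↔
    curvature D (c s) (N s) t ^ 2 * (energyDensity D c N s t - a) = 0 := by
  have h2 := (h.path.omega_pos hs ht).ne'
  have h3 : 1 + curvature D (c s) (N s) t ^ 2 ≠ 0 := by positivity
  rw [h.pathDeriv_omega hs ht, eq_div_iff h3, energyDensity, ← mul_right_inj' h2 (b := _ * _),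
    ← sub_eq_zero]
  constructor
  · intro h4
    refine mul_left_cancel₀ h2 (mul_left_cancel₀ h2 ?_)
    linear_combination h4
  · intro h4
    linear_combination omega D (c s) t ^ 2 * h4

/-- For constant curvatures and parallel tangent field, the length elements of the curves of the
path are proportional. -/
theorem omega_mul_omega (h : IsFramedNormalPath D c N)
    (hρ : ∀ s ∈ Icc (0 : ℝ) 1, ∀ t ∈ D.carrier, normalSpeed c N s t ≠ 0)
    (hκ : ∀ s ∈ Icc (0 : ℝ) 1, ∀ t ∈ D.carrier,
      derivWithin (curvature D (c s) (N s)) D.carrier t = 0)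
    (hpar : TangentIsParallel D c) {s s' t t' : ℝ} (hs : s ∈ Icc (0 : ℝ) 1)
    (hs' : s' ∈ Icc (0 : ℝ) 1) (ht : t ∈ D.carrier) (ht' : t' ∈ D.carrier) :
    omega D (c s) t * omega D (c s') t' = omega D (c s') t * omega D (c s) t' := by
  have h1 : omega D (c s) t / omega D (c s) t' = omega D (c s') t / omega D (c s') t' := by
    refine eq_of_hasDerivWithinAt_zero (f := fun s => omega D (c s) t / omega D (c s) t')
      (convex_Icc 0 1) (fun x hx => ?_) hs hs'
    -- Both `ω(·,t)` and `ω(·,t')` have logarithmic derivative `-ρκ`, with the same value at `t` and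
    -- `t'`, so their quotient is constant in `s`.
    have h2 := ((h.path.smoothAt_omega hx ht).hasDerivWithinAt_left ht).fun_div
      ((h.path.smoothAt_omega hx ht').hasDerivWithinAt_left ht') (h.path.omega_pos hx ht').ne'
    refine h2.congr_deriv ?_
    rw [h.pathDeriv_omega hx ht, h.pathDeriv_omega hx ht',
      h.curvature_eq_of_derivWithin_eq_zero hρ hκ hx ht ht',
      h.normalSpeed_eq_of_tangentIsParallel hpar hx ht ht']
    ring
  rwa [div_eq_div_iff (h.path.omega_pos hs ht').ne' (h.path.omega_pos hs' ht').ne'] at h1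

/-- The factor `ρ²(1+κ²)` depends on `s` only, so the energy density inherits the proportionality of
the length elements. -/
theorem energyDensity_mul_omega (h : IsFramedNormalPath D c N)
    (hρ : ∀ s ∈ Icc (0 : ℝ) 1, ∀ t ∈ D.carrier, normalSpeed c N s t ≠ 0)
    (hκ : ∀ s ∈ Icc (0 : ℝ) 1, ∀ t ∈ D.carrier,
      derivWithin (curvature D (c s) (N s)) D.carrier t = 0)
    (hpar : TangentIsParallel D c) {s s' t t' : ℝ} (hs : s ∈ Icc (0 : ℝ) 1)
    (hs' : s' ∈ Icc (0 : ℝ) 1) (ht : t ∈ D.carrier) (ht' : t' ∈ D.carrier) :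
    energyDensity D c N s t * omega D (c s') t' = energyDensity D c N s t' * omega D (c s') t := by
  have h1 := h.omega_mul_omega hρ hκ hpar hs hs' ht ht'
  rw [energyDensity, energyDensity, h.curvature_eq_of_derivWithin_eq_zero hρ hκ hs ht ht',
    h.normalSpeed_eq_of_tangentIsParallel hpar hs ht ht']
  linear_combination
    (normalSpeed c N s t' ^ 2 * (1 + curvature D (c s) (N s) t' ^ 2)) * h1

/-- A path with parallel tangent field is a geodesic iff its energy density does not depend on
the path parameter. -/
theorem hasConstantSpeed_iff (h : IsFramedNormalPath D c N)
    (hρ : ∀ s ∈ Icc (0 : ℝ) 1, ∀ t ∈ D.carrier, normalSpeed c N s t ≠ 0)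
    (hκ : ∀ s ∈ Icc (0 : ℝ) 1, ∀ t ∈ D.carrier,
      derivWithin (curvature D (c s) (N s)) D.carrier t = 0)
    (hpar : TangentIsParallel D c) : HasConstantSpeed D c ↔
    ∀ s ∈ Icc (0 : ℝ) 1, ∀ t ∈ D.carrier, energyDensity D c N s t = energyDensity D c N 0 t := by
  have h0I : (0 : ℝ) ∈ Icc (0 : ℝ) 1 := ⟨le_rfl, zero_le_one⟩
  have h0C := D.zero_mem_carrier
  have hω0 := h.path.omega_pos h0I h0C
  have hsq : ∀ s ∈ Icc (0 : ℝ) 1, sobolevMetric D (c s) (pathVelocity c s) (pathVelocity c s) =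
      ∫ t in (0 : ℝ)..D.length, energyDensity D c N s t := by
    intro s hs
    rw [h.sobolevMetric_pathVelocity hs hρ]
    refine intervalIntegral.integral_congr fun t ht => ?_
    rw [uIcc_of_le D.length_pos.le] at ht
    have ht := D.Icc_subset_carrier ht
    have h1 := (arcDeriv_eq_zero_iff h.path hs ht).2 (h.tangentIsParallel_iff.1 hpar s hs t ht)
    simp only [h1, energyDensity]
    ring
  -- The energy equals the density at `t = 0` times a positive constant free of `s`, so constant
  -- speed is a condition on that single value.
  have hint : ∀ s ∈ Icc (0 : ℝ) 1, ∫ t in (0 : ℝ)..D.length, energyDensity D c N s t =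
      energyDensity D c N s 0 *
        ((omega D (c 0) 0)⁻¹ * ∫ t in (0 : ℝ)..D.length, omega D (c 0) t) := by
    intro s hs
    rw [← mul_assoc, ← intervalIntegral.integral_const_mul]
    refine intervalIntegral.integral_congr fun t ht => ?_
    rw [uIcc_of_le D.length_pos.le] at ht
    have ht := D.Icc_subset_carrier ht
    have h1 := h.energyDensity_mul_omega hρ hκ hpar hs h0I ht h0C
    field_simp
    linear_combination h1
  have hL : 0 < ∫ t in (0 : ℝ)..D.length, omega D (c 0) t := by
    have hc := (h.contDiffOn_omega h0I).continuousOn.mono D.Icc_subset_carrier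
    exact intervalIntegral.integral_pos D.length_pos hc
      (fun x hx => (h.path.omega_pos h0I (D.Icc_subset_carrier (Ioc_subset_Icc_self hx))).le)
      ⟨0, ⟨le_rfl, D.length_pos.le⟩, hω0⟩
  have hL' : 0 < (omega D (c 0) 0)⁻¹ * ∫ t in (0 : ℝ)..D.length, omega D (c 0) t :=
    mul_pos (inv_pos.2 hω0) hL
  have hspeed : ∀ s ∈ Icc (0 : ℝ) 1, pathSpeed D c s = Real.sqrt (energyDensity D c N s 0 *
      ((omega D (c 0) 0)⁻¹ * ∫ t in (0 : ℝ)..D.length, omega D (c 0) t)) := fun s hs => by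
    rw [pathSpeed, hsq s hs, hint s hs]
  constructor
  · intro hcs s hs t ht
    have h1 : pathSpeed D c s = pathSpeed D c 0 :=
      eq_of_hasDerivWithinAt_zero (convex_Icc 0 1) hcs hs h0I
    rw [hspeed s hs, hspeed 0 h0I, Real.sqrt_inj
      (mul_pos (h.energyDensity_pos hρ hs h0C) hL').le
      (mul_pos (h.energyDensity_pos hρ h0I h0C) hL').le] at h1
    have h2 := mul_right_cancel₀ hL'.ne' h1
    have h3 := h.energyDensity_mul_omega hρ hκ hpar hs h0I ht h0C
    have h4 := h.energyDensity_mul_omega hρ hκ hpar h0I h0I ht h0C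
    rw [h2, ← h4] at h3
    exact mul_right_cancel₀ hω0.ne' h3
  · intro hE s hs
    have h1 : ∀ r ∈ Icc (0 : ℝ) 1, pathSpeed D c r = pathSpeed D c 0 := fun r hr => by
      rw [hspeed r hr, hspeed 0 h0I, hE r hr 0 h0C]
    exact (hasDerivWithinAt_const s _ (pathSpeed D c 0)).congr h1 (h1 s hs)

/-- The equation determines the density only where `κ ≠ 0`; density of those `s` and continuity
extend the value to all `s`. -/
theorem energyDensity_eq_of_dense (h : IsFramedNormalPath D c N)
    (hρ : ∀ s ∈ Icc (0 : ℝ) 1, ∀ t ∈ D.carrier, normalSpeed c N s t ≠ 0)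
    (hd : Icc (0 : ℝ) 1 ⊆
      closure {s | s ∈ Icc (0 : ℝ) 1 ∧ ∃ t ∈ D.carrier, curvature D (c s) (N s) t ≠ 0})
    (hκ : ∀ s ∈ Icc (0 : ℝ) 1, ∀ t ∈ D.carrier,
      derivWithin (curvature D (c s) (N s)) D.carrier t = 0) {a : ℝ} (ht : t ∈ D.carrier)
    (ha : ∀ s ∈ Icc (0 : ℝ) 1,
      curvature D (c s) (N s) t ^ 2 * (energyDensity D c N s t - a) = 0)
    (hs : s ∈ Icc (0 : ℝ) 1) : energyDensity D c N s t = a := by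
  rw [← sub_eq_zero]
  have hsm : ∀ s ∈ Icc (0 : ℝ) 1, SmoothAt D (fun s t => energyDensity D c N s t - a) s t := by
    intro s hs
    have h1 := h.smoothAt_normalSpeed hs ht
    have h2 := h.smoothAt_curvature hs ht hρ
    have h3 := ((h1.mul h1).mul ((SmoothAt.const 1).add (h2.mul h2))).mul
      (h.path.smoothAt_omega hs ht)
    refine SmoothAt.sub ?_ (SmoothAt.const a)
    unfold energyDensity
    simpa only [pow_two] using h3
  refine eq_zero_of_subset_closure (f := fun s => energyDensity D c N s t - a)
    (SmoothAt.continuousOn_left (D := D) (f := fun s t => energyDensity D c N s t - a) hsm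
      ht) (fun s hs => hs.1) hd ?_ hs
  rintro s ⟨hs, t', ht', hne⟩
  rw [h.curvature_eq_of_derivWithin_eq_zero hρ hκ hs ht' ht] at hne
  exact (mul_eq_zero.1 (ha s hs)).resolve_left (pow_ne_zero 2 hne)

theorem hasConstantSpeed_iff_exists_function (h : IsFramedNormalPath D c N)
    (hρ : ∀ s ∈ Icc (0 : ℝ) 1, ∀ t ∈ D.carrier, normalSpeed c N s t ≠ 0)
    (hd : Icc (0 : ℝ) 1 ⊆
      closure {s | s ∈ Icc (0 : ℝ) 1 ∧ ∃ t ∈ D.carrier, curvature D (c s) (N s) t ≠ 0})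
    (hκ : ∀ s ∈ Icc (0 : ℝ) 1, ∀ t ∈ D.carrier,
      derivWithin (curvature D (c s) (N s)) D.carrier t = 0)
    (hpar : TangentIsParallel D c) : HasConstantSpeed D c ↔
    ∃ α : ℝ → ℝ, (∀ t ∈ D.carrier, 0 < α t) ∧ ∀ s ∈ Icc (0 : ℝ) 1, ∀ t ∈ D.carrier,
      pathDeriv (fun a b => omega D (c a) b) s t ^ 2 = α t * omega D (c s) t *
        curvature D (c s) (N s) t ^ 2 / (1 + curvature D (c s) (N s) t ^ 2) := by
  have h0I : (0 : ℝ) ∈ Icc (0 : ℝ) 1 := ⟨le_rfl, zero_le_one⟩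
  rw [h.hasConstantSpeed_iff hρ hκ hpar]
  constructor
  · intro hE
    -- The function `α` is the energy density, which does not depend on `s`; its value at `s = 0` is
    -- taken.
    refine ⟨energyDensity D c N 0, fun t ht => h.energyDensity_pos hρ h0I ht, fun s hs t ht => ?_⟩
    rw [h.pathDeriv_omega_sq_iff hs ht, hE s hs t ht, sub_self, mul_zero]
  · rintro ⟨α, -, hα⟩ s hs t ht
    have h1 : ∀ s ∈ Icc (0 : ℝ) 1, energyDensity D c N s t = α t := fun s hs =>
      h.energyDensity_eq_of_dense hρ hd hκ ht
        (fun r hr => (h.pathDeriv_omega_sq_iff hr ht _).1 (hα r hr t ht)) hs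
    rw [h1 s hs, h1 0 h0I]

theorem hasConstantSpeed_iff_exists_const (h : IsFramedNormalPath D c N)
    (hρ : ∀ s ∈ Icc (0 : ℝ) 1, ∀ t ∈ D.carrier, normalSpeed c N s t ≠ 0)
    (hd : Icc (0 : ℝ) 1 ⊆
      closure {s | s ∈ Icc (0 : ℝ) 1 ∧ ∃ t ∈ D.carrier, curvature D (c s) (N s) t ≠ 0})
    (hκ : ∀ s ∈ Icc (0 : ℝ) 1, ∀ t ∈ D.carrier,
      derivWithin (curvature D (c s) (N s)) D.carrier t = 0)
    (hpar : TangentIsParallel D c)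
    (hω : ∃ s ∈ Icc (0 : ℝ) 1, ∀ t ∈ D.carrier, ∀ t' ∈ D.carrier,
      omega D (c s) t = omega D (c s) t') : HasConstantSpeed D c ↔
    ∃ α : ℝ, 0 < α ∧ ∀ s ∈ Icc (0 : ℝ) 1, ∀ t ∈ D.carrier,
      pathDeriv (fun a b => omega D (c a) b) s t ^ 2 = α * omega D (c s) t *
        curvature D (c s) (N s) t ^ 2 / (1 + curvature D (c s) (N s) t ^ 2) := by
  have h0I : (0 : ℝ) ∈ Icc (0 : ℝ) 1 := ⟨le_rfl, zero_le_one⟩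
  have h0C := D.zero_mem_carrier
  constructor
  · intro hcs
    rw [h.hasConstantSpeed_iff hρ hκ hpar] at hcs
    obtain ⟨s₀, hs₀, hω⟩ := hω
    -- The density at `s = 0` is proportional in `t` to `ω(s₀,·)`, hence constant, so its value at
    -- `t = 0` serves for all `t`.
    refine ⟨energyDensity D c N 0 0, h.energyDensity_pos hρ h0I h0C, fun s hs t ht => ?_⟩
    have h1 := h.energyDensity_mul_omega hρ hκ hpar h0I hs₀ ht h0C
    rw [hω t ht 0 h0C] at h1
    have h2 := mul_right_cancel₀ (h.path.omega_pos hs₀ h0C).ne' h1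
    rw [h.pathDeriv_omega_sq_iff hs ht, hcs s hs t ht, h2, sub_self, mul_zero]
  · rintro ⟨α, hα0, hα⟩
    exact (h.hasConstantSpeed_iff_exists_function hρ hd hκ hpar).2
      ⟨fun _ => α, fun _ _ => hα0, hα⟩

/-- The evolution of the curvature along a horizontal normal path. -/
theorem sq_mul_pathDeriv_curvature (h : IsFramedNormalPath D c N) (hhor : IsHorizontalPath D c)
    (hρ : ∀ s ∈ Icc (0 : ℝ) 1, ∀ t ∈ D.carrier, normalSpeed c N s t ≠ 0)
    (hs : s ∈ Icc (0 : ℝ) 1) (ht : t ∈ D.carrier) :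
    4 * curvature D (c s) (N s) t ^ 2 *
        pathDeriv (fun a b => curvature D (c a) (N a) b) s t =
      normalSpeed c N s t * (3 * arcDeriv D (c s) (curvature D (c s) (N s)) t ^ 2
        + 4 * curvature D (c s) (N s) t ^ 2 * (curvature D (c s) (N s) t ^ 2 +
          sectionalCurvature (c s t) (N s t) (unitTangent D (c s) t))
        - 2 * curvature D (c s) (N s) t *
          arcDeriv D (c s) (arcDeriv D (c s) (curvature D (c s) (N s))) t) := by
  have hρs := h.smoothAt_normalSpeed hs ht
  have hκs := h.smoothAt_curvature hs ht hρ
  have d1 := hρs.hasDerivWithinAt_right hs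
  have d2 := hκs.hasDerivWithinAt_right hs
  have d3 := (smoothAt_arcDeriv h.path hρs hs ht).hasDerivWithinAt_right hs
  have d4 := (smoothAt_arcDeriv h.path hκs hs ht).hasDerivWithinAt_right hs
  have hzero : ∀ b ∈ D.carrier, 2 * (arcDeriv D (c s) (normalSpeed c N s) b *
      curvature D (c s) (N s) b) + normalSpeed c N s b *
        arcDeriv D (c s) (curvature D (c s) (N s)) b = 0 := by
    intro b hb
    have h1 := h.horizontal_equation hhor hρ hs hb
    simp only [arcDeriv]
    linear_combination (omega D (c s) b)⁻¹ * h1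
  -- Horizontality holds along the whole curve, so it may be differentiated: `2ρ_θθκ + 3ρ_θκ_θ +
  -- ρκ_θθ = 0`.
  have e := (D.uniqueDiffOn_carrier t ht).eq_deriv _
    (((d3.fun_mul d2).const_mul 2).fun_add (d1.fun_mul d4))
    ((hasDerivWithinAt_const t D.carrier (0 : ℝ)).congr hzero (hzero t ht))
  have e0 := hzero t ht
  rw [h.pathDeriv_curvature hs ht hρ]
  have r1 : arcDeriv D (c s) (normalSpeed c N s) t =
    (omega D (c s) t)⁻¹ * curveDeriv D (normalSpeed c N) s t := rfl
  have r2 : arcDeriv D (c s) (curvature D (c s) (N s)) t =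
    (omega D (c s) t)⁻¹ * curveDeriv D (fun a b => curvature D (c a) (N a) b) s t := rfl
  have r3 : arcDeriv D (c s) (fun b => arcDeriv D (c s) (normalSpeed c N s) b) t =
    (omega D (c s) t)⁻¹ *
      curveDeriv D (fun a b => arcDeriv D (c a) (normalSpeed c N a) b) s t := rfl
  have r4 : arcDeriv D (c s) (arcDeriv D (c s) (curvature D (c s) (N s))) t =
    (omega D (c s) t)⁻¹ *
      curveDeriv D (fun a b => arcDeriv D (c a) (curvature D (c a) (N a)) b) s t := rfl
  have e1 : 2 * arcDeriv D (c s) (fun b => arcDeriv D (c s) (normalSpeed c N s) b) t *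
        curvature D (c s) (N s) t +
      3 * arcDeriv D (c s) (normalSpeed c N s) t *
        arcDeriv D (c s) (curvature D (c s) (N s)) t +
      normalSpeed c N s t *
        arcDeriv D (c s) (arcDeriv D (c s) (curvature D (c s) (N s))) t = 0 := by
    have e2 := congrArg (fun x => (omega D (c s) t)⁻¹ * x) e
    simp only [mul_zero] at e2
    rw [r3, r4]
    rw [r1, r2] at e2 ⊢
    linear_combination e2
  -- Multiplying by `2κ` allows `2κρ_θ = -ρκ_θ` to remove `ρ_θ`, leaving `ρ_θθ` in terms of `ρ`, `κ`
  -- and derivatives of `κ`.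
  linear_combination (2 * curvature D (c s) (N s) t) * e1 -
    3 * arcDeriv D (c s) (curvature D (c s) (N s)) t * e0

theorem sq_mul_pathDeriv_curvature_eq_zero_iff (h : IsFramedNormalPath D c N)
    (hhor : IsHorizontalPath D c)
    (hρ : ∀ s ∈ Icc (0 : ℝ) 1, ∀ t ∈ D.carrier, normalSpeed c N s t ≠ 0)
    (hs : s ∈ Icc (0 : ℝ) 1) (ht : t ∈ D.carrier) :
    4 * curvature D (c s) (N s) t ^ 2 *
        pathDeriv (fun a b => curvature D (c a) (N a) b) s t = 0 ↔
      2 * curvature D (c s) (N s) t *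
          arcDeriv D (c s) (arcDeriv D (c s) (curvature D (c s) (N s))) t =
        3 * arcDeriv D (c s) (curvature D (c s) (N s)) t ^ 2
          + 4 * curvature D (c s) (N s) t ^ 2 * (curvature D (c s) (N s) t ^ 2 +
            sectionalCurvature (c s t) (N s t) (unitTangent D (c s) t)) := by
  rw [h.sq_mul_pathDeriv_curvature hhor hρ hs ht, mul_eq_zero, or_iff_right (hρ s hs t ht),
    sub_eq_zero, eq_comm]

/-- Dividing by `κ²` fails at zeros of `κ`. But `κ²κ'` is a third of the derivative of `κ³`, so `κ³`
is constant in `s`, and cubing is injective. -/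
theorem pathDeriv_curvature_eq_zero_of_forall (h : IsFramedNormalPath D c N)
    (hρ : ∀ s ∈ Icc (0 : ℝ) 1, ∀ t ∈ D.carrier, normalSpeed c N s t ≠ 0)
    (ht : t ∈ D.carrier) (h0 : ∀ s ∈ Icc (0 : ℝ) 1, 4 * curvature D (c s) (N s) t ^ 2 *
      pathDeriv (fun a b => curvature D (c a) (N a) b) s t = 0) (hs : s ∈ Icc (0 : ℝ) 1) :
    pathDeriv (fun a b => curvature D (c a) (N a) b) s t = 0 := by
  have h1 : ∀ r ∈ Icc (0 : ℝ) 1, curvature D (c r) (N r) t = curvature D (c s) (N s) t := by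
    intro r hr
    have h2 : curvature D (c r) (N r) t ^ 3 = curvature D (c s) (N s) t ^ 3 := by
      refine eq_of_hasDerivWithinAt_zero (f := fun r => curvature D (c r) (N r) t ^ 3)
        (convex_Icc 0 1) (fun x hx => ?_) hr hs
      refine (((h.smoothAt_curvature hx ht hρ).hasDerivWithinAt_left ht).fun_pow 3).congr_deriv ?_
      have h3 := h0 x hx
      push_cast
      linear_combination (3 / 4) * h3
    exact (Odd.strictMono_pow (by decide : Odd 3)).injective h2
  have h3 := ((hasDerivWithinAt_const s (Icc 0 1) (curvature D (c s) (N s) t)).congr h1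
    (h1 s hs)).derivWithin (uniqueDiffOn_Icc zero_lt_one s hs)
  exact h3

end IsFramedNormalPath

end Results

end SurfaceCurves

/-! ### Assembly of the two statements -/

theorem mainTheorem2
    {M : Type*} [TopologicalSpace M] [ChartedSpace (EuclideanSpace ℝ (Fin 2)) M]
    [IsManifold (𝓡 2) ∞ M] [RiemannianBundle (fun x : M => TangentSpace (𝓡 2) x)]
    [IsContMDiffRiemannianBundle (𝓡 2) ∞ (EuclideanSpace ℝ (Fin 2))
      (fun x : M => TangentSpace (𝓡 2) x)]
    (D : SurfaceCurves.ParamDomain) (c : ℝ → ℝ → M)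
    (N : (s t : ℝ) → TangentSpace (𝓡 2) (c s t))
    (hc : SurfaceCurves.IsCurvePath D c)
    (hN : SurfaceCurves.IsUnitNormalField D c N)
    (hnormal : SurfaceCurves.IsNormalPath D c)
    (hhor : SurfaceCurves.IsHorizontalPath D c)
    (om κ κθ κθθ ρ K : ℝ → ℝ → ℝ)
    (h_om : om = fun s t => SurfaceCurves.omega D (c s) t)
    (hκ : κ = fun s t => SurfaceCurves.curvature D (c s) (N s) t)
    (hκθ : κθ = fun s t => SurfaceCurves.arcDeriv D (c s) (κ s) t)
    (hκθθ : κθθ = fun s t => SurfaceCurves.arcDeriv D (c s) (κθ s) t)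
    (hρ : ρ = fun s t => inner ℝ (SurfaceCurves.pathVelocity c s t) (N s t))
    (hK : K = fun s t => SurfaceCurves.sectionalCurvature (c s t) (N s t)
      (SurfaceCurves.unitTangent D (c s) t))
    (hρ0 : ∀ s ∈ Set.Icc (0 : ℝ) 1, ∀ t ∈ D.carrier, ρ s t ≠ 0) :
    -- (a), first direction
    (SurfaceCurves.TangentIsParallel D c →
      ∀ s ∈ Set.Icc (0 : ℝ) 1, ∀ t ∈ D.carrier, κθ s t = 0) ∧
    -- (a), the converse and the geodesic equation, if the curves with `κ ≢ 0` are dense in the path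
    (Set.Icc (0 : ℝ) 1 ⊆ closure {s | s ∈ Set.Icc (0 : ℝ) 1 ∧ ∃ t ∈ D.carrier, κ s t ≠ 0} →
      (∀ s ∈ Set.Icc (0 : ℝ) 1, ∀ t ∈ D.carrier, κθ s t = 0) →
      SurfaceCurves.TangentIsParallel D c ∧
      (SurfaceCurves.HasConstantSpeed D c ↔
        ∃ α : ℝ → ℝ, (∀ t ∈ D.carrier, 0 < α t) ∧
          ∀ s ∈ Set.Icc (0 : ℝ) 1, ∀ t ∈ D.carrier,
            SurfaceCurves.pathDeriv om s t ^ 2 = α t * om s t * κ s t ^ 2 / (1 + κ s t ^ 2)) ∧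
      -- one curve of the path has constant speed parametrization
      ((∃ s ∈ Set.Icc (0 : ℝ) 1, ∀ t ∈ D.carrier, ∀ t' ∈ D.carrier, om s t = om s t') →
        (SurfaceCurves.HasConstantSpeed D c ↔
          ∃ α : ℝ, 0 < α ∧ ∀ s ∈ Set.Icc (0 : ℝ) 1, ∀ t ∈ D.carrier,
            SurfaceCurves.pathDeriv om s t ^ 2 = α * om s t * κ s t ^ 2 / (1 + κ s t ^ 2)))) ∧
    -- (b), along the whole path
    ((∀ s ∈ Set.Icc (0 : ℝ) 1, ∀ t ∈ D.carrier, SurfaceCurves.pathDeriv κ s t = 0) ↔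
      ∀ s ∈ Set.Icc (0 : ℝ) 1, ∀ t ∈ D.carrier,
        2 * κ s t * κθθ s t = 3 * κθ s t ^ 2 + 4 * κ s t ^ 2 * (κ s t ^ 2 + K s t)) ∧
    -- (b), at a single point with `κ ≠ 0`
    (∀ s ∈ Set.Icc (0 : ℝ) 1, ∀ t ∈ D.carrier, κ s t ≠ 0 →
      (SurfaceCurves.pathDeriv κ s t = 0 ↔
        2 * κ s t * κθθ s t = 3 * κθ s t ^ 2 + 4 * κ s t ^ 2 * (κ s t ^ 2 + K s t))) := by
  have h : SurfaceCurves.IsFramedNormalPath D c N := ⟨hc, hN, hnormal⟩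
  subst h_om hκ hκθ hκθθ hρ hK
  have hρ' : ∀ s ∈ Icc (0 : ℝ) 1, ∀ t ∈ D.carrier, SurfaceCurves.normalSpeed c N s t ≠ 0 := hρ0
  have stationary := fun s hs t ht =>
    h.sq_mul_pathDeriv_curvature_eq_zero_iff (s := s) (t := t) hhor hρ' hs ht
  refine ⟨fun hpar s hs t ht => (SurfaceCurves.arcDeriv_eq_zero_iff hc hs ht).2
    (h.derivWithin_curvature_eq_zero hhor hρ' hpar hs ht), fun hd hκ => ?_, ⟨?_, ?_⟩, ?_⟩
  · have hκ' : ∀ s ∈ Icc (0 : ℝ) 1, ∀ t ∈ D.carrier,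
        derivWithin (SurfaceCurves.curvature D (c s) (N s)) D.carrier t = 0 := fun s hs t ht =>
      (SurfaceCurves.arcDeriv_eq_zero_iff hc hs ht).1 (hκ s hs t ht)
    have hpar := h.tangentIsParallel_of_dense hhor hρ' hd hκ'
    exact ⟨hpar, h.hasConstantSpeed_iff_exists_function hρ' hd hκ' hpar,
      h.hasConstantSpeed_iff_exists_const hρ' hd hκ' hpar⟩
  · intro h0 s hs t ht
    exact (stationary s hs t ht).1 (mul_eq_zero_of_right _ (h0 s hs t ht))
  · intro h0 s hs t ht
    -- The identity is needed on the whole `s`-line through `t`, not only at `s`, to conclude where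
    -- `κ` vanishes.
    exact h.pathDeriv_curvature_eq_zero_of_forall hρ' ht
      (fun r hr => (stationary r hr t ht).2 (h0 r hr t ht)) hs
  · intro s hs t ht hne
    refine Iff.trans ?_ (stationary s hs t ht)
    have hne' : 4 * SurfaceCurves.curvature D (c s) (N s) t ^ 2 ≠ 0 :=
      mul_ne_zero four_ne_zero (pow_ne_zero 2 hne)
    rw [mul_eq_zero, or_iff_right hne']
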